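/- Let $q=p^m>5$ be an odd prime power ($p$ prime) and let $N\le q-2$ be a positive integer. A linear code with parameters $[N,K]$ over $\mathbb F_q$ is a $K$-dimensional subspace $C\subseteq\mathbb F_q^N$; it is MDS if its minimum Hamming distance is $N-K+1$, and it is a $1$-$d$-hull code if $\dim(C\cap C^\perp)=1$, where $C^\perp$ is the dual for $x\cdot y=\sum_i x_iy_i$. Let $$K=\begin{cases}N-2s-1,&\text{if } N\text{ is even, with } 1\le s\le \frac N2-2,\\ N-2s-2,&\text{if } N\text{ is odd, with } 0\le s\le\frac{N+1}2-3.\end{cases}$$ Then, for every such $s$, there exist $1$-$d$-hull MDS codes over $\mathbb F_q$ with parameters $[N,K]$ and $[N,N-K]$ whenever one of the following conditions holds (all letters denote integers, and every quotient said to be an integer, odd, or even is in particular required to be an integer): 1. $p\mid N$, $(N-1)\mid(q-1)$, $N$ even; 2. $q$ is a perfect square, $(N-1)\mid(q-1)$, $N$ even; 3. $N\mid\frac{q-1}2$, and either (a) $N$ is even, or (b) $q\equiv1\pmod 4$ and $N$ is odd; 4. $N=(t+1)n$, where $1\le r<m$, $n=\frac{q-1}{p^r+1}$ is an integer whose image in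 $\mathbb F_q$ is a square, $\frac{n(p^r+1)}{2(p^r-1)}$ is odd, $t$ is odd, and $1\le t\le\lfloor\frac{q-2}n\rfloor-1$; 5. $N=(t+1)n$, where $1\le r<m$, $n=\frac{q-1}{p^r+1}$ is an integer whose image in $\mathbb F_q$ is a square, $\frac{n(p^r+1)}{2(p^r-1)}$ is even, and $1\le t\le\lfloor\frac{q-2}n\rfloor-1$; 6. $N=(t+1)n$, where $1\le r<m$, $m$ is even, $r\mid\frac m2$, $n=\frac{q-1}{p^r-1}$ is an integer whose image in $\mathbb F_q$ is a square, and $1\le t\le p^r-2$; 7. $m=2m_0$, $q_0=p^{m_0}$, $N=q_0t$, $t$ even, $1\le t<q_0$; 8. $m=2m_0$, $q_0=p^{m_0}$, $N=q_0t+1$, $t$ odd, $1\le t<q_0$; 9. $m$ even, $r=p^{m_0}$, $m_0\mid\frac m2$, $N=2tr^\ell$, $0\le\ell<m/m_0$, $1\le t\le\min\left(\frac{r-1}2,\lfloor\frac{q-2}{2r^\ell}\rfloor\right)$; 10. $q\equiv1\pmod4$, $N=2p^\ell$, $0<\ell<m$; 11. $m$ even, $r=p^{m_0}$, $m_0\mid\frac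 m2$, $N=(2t+1)r^\ell+1$, $0\le\ell<m/m_0$, $0\le t\le\min\left(\frac{r-1}2,\lfloor\frac{q-2-r^\ell}{2r^\ell}\rfloor\right)$; 12. $q\equiv1\pmod4$, $N=p^\ell+1$, $0<\ell<m$. -/

import Mathlib

namespace LinearCode

/-- The Euclidean dual of a linear code of length `N` over `F`. -/
def dual {F : Type*} [Field F] {N : ℕ} (C : Submodule F (Fin N → F)) :
    Submodule F (Fin N → F) where
  carrier := {y | ∀ x ∈ C, x ⬝ᵥ y = 0}
  zero_mem' := fun x _ => dotProduct_zero x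
  add_mem' := fun {a b} ha hb x hx => by
    rw [dotProduct_add, ha x hx, hb x hx, add_zero]
  smul_mem' := fun c a ha x hx => by
    rw [dotProduct_smul, ha x hx, smul_zero]

/-- The Euclidean hull, the intersection of a code with its dual. -/
def hull {F : Type*} [Field F] {N : ℕ} (C : Submodule F (Fin N → F)) :
    Submodule F (Fin N → F) :=
  C ⊓ dual C

/-- The minimum Hamming weight of a nonzero codeword (with value `0` for the zero code). -/
noncomputable def minDist {F : Type*} [Field F] [DecidableEq F] {N : ℕ}
    (C : Submodule F (Fin N → F)) : ℕ :=
  sInf {w | ∃ x ∈ C, x ≠ 0 ∧ hammingNorm x = w}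

/-- A code is MDS if it meets the Singleton bound, `d = N - k + 1`.
The zero code is not MDS. -/
def IsMDS {F : Type*} [Field F] [DecidableEq F] {N : ℕ}
    (C : Submodule F (Fin N → F)) : Prop :=
  minDist C + Module.finrank F C = N + 1

/-- `C` is an MDS code with parameters `[N, K]` whose hull has dimension `1`. -/
def IsOneDimHullMDS {F : Type*} [Field F] [DecidableEq F] {N : ℕ}
    (C : Submodule F (Fin N → F)) (K : ℕ) : Prop :=
  Module.finrank F C = K ∧ IsMDS C ∧ Module.finrank F (hull C) = 1

end LinearCode

/-!
The codes are generalized Reed–Solomon codes `{(vᵢ f(aᵢ))ᵢ : deg f < K}`. With `δ(a) = ∏_{b ≠ a}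
(a - b)`, the product over the other evaluation points, the dual code is the Reed–Solomon code
with multipliers `1 / (vᵢ δ(aᵢ))` and degree bound `N - K` (`dual_grs`). Suppose that `v² = λ h₁ /
(h₂ δ)` on the evaluation points, where `h₁` and `h₂` are coprime, `h₁` has degree `N - K - 1` and
`h₂` has degree at most `K - 1`. A word of the hull, given by `f` in the code and by `g` in the
dual, satisfies `λ h₁ f = h₂ g`, at first on the points and then, by degrees, as polynomials.
Hence `f` is a scalar multiple of `h₂`, and the hull is a line (`finrank_hull_grs`). The dual code
has the same hull. Such a `v` exists exactly when `λ h₁ h₂ δ` takes nonzero square values on the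
evaluation points, and the theorem becomes a search for point sets with this property.

For even `N`, so that `N - K - 1 = 2 s`, take `h₁ = (X - c) ^ (2 s)` and `h₂ = X ^ j` with `j ∈
{0, 1}`: it remains to find `N` points at which `a ^ j δ(a)` is a square up to a common factor
(`HasSquareWeights`). For odd `N` all families but one are empty, and in that one `N ∣ q - 1`, so
that a coset of the `N`-th roots of unity and `h₁ = X ^ (2 s + 1)` work.

The point sets are of three kinds.
* Roots of `X ^ N - X`, and unions of cosets of a group of `n`-th roots of unity, described by
  their images `B` under `a ↦ a ^ n`. There `δ(a) = n a ^ (n - 1) ∏ (a ^ n - b)` over the other `b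
  ∈ B`. If `B` lies in a subfield `R` such that `m / 2` is a multiple of the degree of `R`, then
  all elements of `R`, in particular the factors `a ^ n - b`, are squares. If the elements of `B`
  have order dividing `Q + 1`, then `(x - y) ^ (Q - 1) = -1 / (x y)` on `B`, which determines the
  quadratic character of `δ(a)`; a suitable `j` makes it constant.
* Unions of cosets `c e + H` of a subspace `H` over a subfield, with `c` in that subfield. Here
  `δ(a)` is a product of factors `c - c'`, up to a constant; these factors are squares, or equal
  to `±1` with `-1` a square.
* An odd number of such cosets together with the point at infinity, brought back to the affine
  line by a Möbius map (`HasSquareWeights.of_odd_card`).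
-/

namespace LinearCode

open Polynomial

/-! ### Generalized Reed–Solomon codes and their duals -/

section ReedSolomon

variable {F : Type*} [Field F] {N : ℕ}

/-- The weighted evaluation map `f ↦ (v i * f (a i))ᵢ`. -/
noncomputable def weightedEval (a v : Fin N → F) : F[X] →ₗ[F] (Fin N → F) :=
  LinearMap.pi fun i => v i • Polynomial.leval (a i)

@[simp] lemma weightedEval_apply (a v : Fin N → F) (f : F[X]) (i : Fin N) :
    weightedEval a v f i = v i * f.eval (a i) := by
  simp [weightedEval, Polynomial.leval]

/-- The generalized Reed–Solomon code of dimension `k` with evaluation points `a` and column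
multipliers `v`. -/
noncomputable def grs (a v : Fin N → F) (k : ℕ) : Submodule F (Fin N → F) :=
  (degreeLT F k).map (weightedEval a v)

lemma mem_grs {a v : Fin N → F} {k : ℕ} {x : Fin N → F} :
    x ∈ grs a v k ↔ ∃ f : F[X], f.degree < k ∧ ∀ i, x i = v i * f.eval (a i) := by
  simp only [grs, Submodule.mem_map, mem_degreeLT]
  refine exists_congr fun f => and_congr_right fun _ => ?_
  constructor
  · rintro rfl i
    simp
  · intro h
    ext i
    simp [h]

lemma eq_zero_of_eval_eq_zero {a : Fin N → F} (ha : Function.Injective a) {f : F[X]}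
    (hf : f.degree < N) (h : ∀ i, f.eval (a i) = 0) : f = 0 := by
  refine eq_zero_of_degree_lt_of_eval_index_eq_zero (s := Finset.univ) (v := a) ha.injOn ?_
    fun i _ => h i
  simpa using hf

lemma finrank_grs {a v : Fin N → F} (ha : Function.Injective a) (hv : ∀ i, v i ≠ 0) {k : ℕ}
    (hk : k ≤ N) : Module.finrank F (grs a v k) = k := by
  have hinj : Function.Injective ((weightedEval a v).domRestrict (degreeLT F k)) := by
    rw [injective_iff_map_eq_zero]
    rintro ⟨f, hf⟩ h
    rw [mem_degreeLT] at hf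
    have hf' : f.degree < N := hf.trans_le (by exact_mod_cast hk)
    refine Subtype.ext (eq_zero_of_eval_eq_zero ha hf' fun i => ?_)
    have := congrFun h i
    simpa [hv i] using this
  have h1 : grs a v k = LinearMap.range ((weightedEval a v).domRestrict (degreeLT F k)) := by
    rw [grs, LinearMap.range_domRestrict]
  rw [h1, LinearMap.finrank_range_of_inj hinj, (degreeLTEquiv F k).finrank_eq,
    Module.finrank_fin_fun]

/-- Orthogonality of the functional `g ↦ ∑ᵢ g (aᵢ) uᵢ` to polynomials of low degree: it reads off
the coefficient of `X ^ (N - 1)`. -/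
lemma sum_eval_mul_nodalWeight {a : Fin N → F} (ha : Function.Injective a) {g : F[X]}
    (hg : g.degree < N) :
    ∑ i, g.eval (a i) * Lagrange.nodalWeight Finset.univ a i = g.coeff (N - 1) := by
  have := Lagrange.coeff_eq_sum (s := Finset.univ) (v := a) ha.injOn (P := g) (by simpa using hg)
  simp only [Finset.card_univ, Fintype.card_fin] at this
  rw [this]
  refine Finset.sum_congr rfl fun i _ => ?_
  rw [Lagrange.nodalWeight, Finset.prod_inv_distrib, div_eq_mul_inv]

/-- The dual of a generalized Reed–Solomon code is again one, with the same evaluation points. -/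
lemma dual_grs {a v : Fin N → F} (ha : Function.Injective a) (hv : ∀ i, v i ≠ 0) {k : ℕ}
    (hk : k ≤ N) :
    dual (grs a v k) = grs a (fun i => Lagrange.nodalWeight Finset.univ a i / v i) (N - k) := by
  have hw : ∀ i, Lagrange.nodalWeight Finset.univ a i ≠ 0 := fun i =>
    Lagrange.nodalWeight_ne_zero ha.injOn (Finset.mem_univ i)
  ext y
  rw [mem_grs]
  change (∀ x ∈ grs a v k, x ⬝ᵥ y = 0) ↔ _
  constructor
  · intro h
    set r : Fin N → F := fun i => y i * v i / Lagrange.nodalWeight Finset.univ a i with hr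
    set g := Lagrange.interpolate Finset.univ a r with hg
    have hgd : g.degree < N := by
      have := Lagrange.degree_interpolate_lt (s := Finset.univ) r ha.injOn
      rwa [Finset.card_univ, Fintype.card_fin] at this
    have hge : ∀ i, g.eval (a i) = r i := fun i =>
      Lagrange.eval_interpolate_at_node r ha.injOn (Finset.mem_univ i)
    refine ⟨g, ?_, fun i => ?_⟩
    · by_contra hcon
      rw [not_lt] at hcon
      have hg0 : g ≠ 0 := by
        rintro h0
        rw [h0, degree_zero] at hcon
        exact absurd hcon (by simp)
      rw [degree_eq_natDegree hg0] at hcon hgd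
      have h1 : N - k ≤ g.natDegree := by exact_mod_cast hcon
      have h2 : g.natDegree < N := by exact_mod_cast hgd
      -- testing against `X ^ j` with `j = N - 1 - natDegree g` isolates the leading coefficient
      set j := N - 1 - g.natDegree with hj
      have hjk : j < k := by omega
      have hx : weightedEval a v (X ^ j) ∈ grs a v k :=
        Submodule.mem_map_of_mem (mem_degreeLT.2 (by rw [degree_X_pow]; exact_mod_cast hjk))
      have h3 := h _ hx
      have h4 : ∑ i, (g * X ^ j).eval (a i) * Lagrange.nodalWeight Finset.univ a i = 0 := by
        rw [← h3]
        refine Finset.sum_congr rfl fun i _ => ?_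
        rw [weightedEval_apply, eval_mul, hge, hr]
        field_simp [hw i]
      rw [sum_eval_mul_nodalWeight ha] at h4
      · have : N - 1 = g.natDegree + j := by omega
        rw [this, coeff_mul_X_pow, coeff_natDegree, leadingCoeff_eq_zero] at h4
        exact hg0 h4
      · rw [degree_mul, degree_X_pow, degree_eq_natDegree hg0]
        exact_mod_cast (by omega : g.natDegree + j < N)
    · rw [hge, hr]
      field_simp [hw i, hv i]
  · rintro ⟨g, hg, hy⟩ x hx
    obtain ⟨f, hf, hx⟩ := mem_grs.1 hx
    by_cases hf0 : f = 0
    · simp [dotProduct, hx, hf0]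
    by_cases hg0 : g = 0
    · simp [dotProduct, hy, hg0]
    rw [degree_eq_natDegree hf0] at hf
    rw [degree_eq_natDegree hg0] at hg
    have hf' : f.natDegree < k := by exact_mod_cast hf
    have hg' : g.natDegree < N - k := by exact_mod_cast hg
    have h1 : x ⬝ᵥ y = ∑ i, (f * g).eval (a i) * Lagrange.nodalWeight Finset.univ a i := by
      refine Finset.sum_congr rfl fun i _ => ?_
      rw [hx, hy, eval_mul]
      field_simp [hv i]
    have hd : (f * g).natDegree = f.natDegree + g.natDegree := natDegree_mul hf0 hg0
    rw [h1, sum_eval_mul_nodalWeight ha]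
    · exact coeff_eq_zero_of_natDegree_lt (by omega)
    · rw [degree_eq_natDegree (mul_ne_zero hf0 hg0), hd]
      exact_mod_cast (by omega : f.natDegree + g.natDegree < N)

lemma hammingNorm_weightedEval_add_card [DecidableEq F] {a v : Fin N → F} (hv : ∀ i, v i ≠ 0)
    (f : F[X]) :
    hammingNorm (weightedEval a v f) +
      (Finset.univ.filter fun i => f.eval (a i) = 0).card = N := by
  have h : hammingNorm (weightedEval a v f) =
      (Finset.univ.filter fun i => ¬ f.eval (a i) = 0).card := by
    unfold hammingNorm
    congr 1
    ext i
    simp [hv i]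
  rw [h, add_comm, Finset.card_filter_add_card_filter_not, Finset.card_univ, Fintype.card_fin]

lemma isMDS_grs [DecidableEq F] {a v : Fin N → F} (ha : Function.Injective a)
    (hv : ∀ i, v i ≠ 0) {k : ℕ} (hk1 : 1 ≤ k) (hk : k ≤ N) : IsMDS (grs a v k) := by
  have hmin : minDist (grs a v k) = N - k + 1 := by
    apply le_antisymm
    · -- the polynomial vanishing at the first `k - 1` points gives a word of minimum weight
      set S : Finset (Fin N) := Finset.univ.filter fun i => i.val < k - 1 with hS
      have hScard : S.card = k - 1 := by
        have : S = (Finset.univ : Finset (Fin (k - 1))).map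
            (Fin.castLEEmb (by omega : k - 1 ≤ N)) := by
          ext i
          simp only [hS, Finset.mem_filter, Finset.mem_univ, true_and, Finset.mem_map]
          constructor
          · intro h
            exact ⟨⟨i, h⟩, rfl⟩
          · rintro ⟨j, rfl⟩
            exact j.2
        rw [this, Finset.card_map, Finset.card_univ, Fintype.card_fin]
      have hdeg : (Lagrange.nodal S a).degree < k := by
        rw [Lagrange.degree_nodal, hScard]
        exact_mod_cast (by omega : k - 1 < k)
      have hmem : weightedEval a v (Lagrange.nodal S a) ∈ grs a v k :=
        Submodule.mem_map_of_mem (mem_degreeLT.2 hdeg)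
      have hz : (Finset.univ.filter fun i => (Lagrange.nodal S a).eval (a i) = 0) = S := by
        ext i
        simp only [Finset.mem_filter, Finset.mem_univ, true_and, Lagrange.eval_nodal,
          Finset.prod_eq_zero_iff, sub_eq_zero]
        constructor
        · rintro ⟨j, hj, hij⟩
          rwa [ha hij]
        · intro hi
          exact ⟨i, hi, rfl⟩
      have hwt := hammingNorm_weightedEval_add_card (a := a) hv (Lagrange.nodal S a)
      rw [hz, hScard] at hwt
      have : hammingNorm (weightedEval a v (Lagrange.nodal S a)) = N - k + 1 := by omega
      refine Nat.sInf_le ⟨_, hmem, ?_, this⟩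
      rw [← hammingNorm_ne_zero_iff]
      omega
    · have hne : {w | ∃ x ∈ grs a v k, x ≠ 0 ∧ hammingNorm x = w}.Nonempty := by
        have hpos : 0 < Module.finrank F (grs a v k) := by rw [finrank_grs ha hv hk]; omega
        obtain ⟨x, hx⟩ := (Module.finrank_pos_iff_exists_ne_zero).1 hpos
        exact ⟨_, x, x.2, by simpa using hx, rfl⟩
      obtain ⟨x, hx, hx0, hw⟩ := Nat.sInf_mem hne
      change _ ≤ sInf _
      rw [← hw]
      obtain ⟨f, hf, rfl⟩ := Submodule.mem_map.1 hx
      rw [mem_degreeLT] at hf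
      have hf0 : f ≠ 0 := by
        rintro rfl
        exact hx0 (map_zero _)
      have hwt := hammingNorm_weightedEval_add_card (a := a) hv f
      have hroots : (Finset.univ.filter fun i => f.eval (a i) = 0).card ≤ f.natDegree := by
        rw [← Finset.card_image_of_injective _ ha]
        refine (Finset.card_le_card (t := f.roots.toFinset) ?_).trans
          ((Multiset.toFinset_card_le _).trans (card_roots' f))
        intro y hy
        obtain ⟨i, hi, rfl⟩ := Finset.mem_image.1 hy
        simp only [Finset.mem_filter, Finset.mem_univ, true_and] at hi
        simp [hf0, hi]
      rw [degree_eq_natDegree hf0] at hf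
      have hf' : f.natDegree < k := by exact_mod_cast hf
      omega
  rw [IsMDS, hmin, finrank_grs ha hv hk]
  omega

/-! ### Reed–Solomon codes with one-dimensional hull -/

lemma dual_dual_grs {a v : Fin N → F} (ha : Function.Injective a) (hv : ∀ i, v i ≠ 0) {k : ℕ}
    (hk : k ≤ N) : dual (dual (grs a v k)) = grs a v k := by
  have hw : ∀ i, Lagrange.nodalWeight Finset.univ a i ≠ 0 := fun i =>
    Lagrange.nodalWeight_ne_zero ha.injOn (Finset.mem_univ i)
  rw [dual_grs ha hv hk, dual_grs ha (fun i => div_ne_zero (hw i) (hv i)) (Nat.sub_le N k),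
    Nat.sub_sub_self hk]
  congr 1
  ext i
  field_simp [hw i, hv i]

/-- If `v² h₂ = λ u h₁` on the evaluation points, `u` being the dual column multipliers, then a
word `v f = (u / v) g` of the hull satisfies `λ h₁ f = h₂ g` as polynomials, because both sides
have degree at most `N - 2`. Coprimality and the degree of `h₁` leave only multiples of `f = h₂`. -/
lemma finrank_hull_grs {a v : Fin N → F} (ha : Function.Injective a) (hv : ∀ i, v i ≠ 0) {k : ℕ}
    (hk1 : 1 ≤ k) (hk : k < N) {h₁ h₂ : F[X]} {lam : F} (hlam : lam ≠ 0)
    (hd₁ : h₁.natDegree = N - k - 1) (hd₂ : h₂.natDegree ≤ k - 1) (hcop : IsCoprime h₁ h₂)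
    (he₁ : ∀ i, h₁.eval (a i) ≠ 0) (he₂ : ∀ i, h₂.eval (a i) ≠ 0)
    (hsq : ∀ i, v i ^ 2 * h₂.eval (a i) =
      lam * h₁.eval (a i) * Lagrange.nodalWeight Finset.univ a i) :
    Module.finrank F (hull (grs a v k)) = 1 := by
  have i0 : Fin N := ⟨0, by omega⟩
  have h₁0 : h₁ ≠ 0 := by
    rintro rfl
    exact he₁ i0 eval_zero
  have h₂0 : h₂ ≠ 0 := by
    rintro rfl
    exact he₂ i0 eval_zero
  have hw : ∀ i, Lagrange.nodalWeight Finset.univ a i ≠ 0 := fun i =>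
    Lagrange.nodalWeight_ne_zero ha.injOn (Finset.mem_univ i)
  have hspan : hull (grs a v k) = Submodule.span F {weightedEval a v h₂} := by
    rw [hull, dual_grs ha hv hk.le]
    ext x
    rw [Submodule.mem_inf, Submodule.mem_span_singleton, mem_grs, mem_grs]
    constructor
    · rintro ⟨⟨f, hf, hxf⟩, g, hg, hxg⟩
      by_cases hf0 : f = 0
      · refine ⟨0, ?_⟩
        ext i
        simp [hxf, hf0]
      have hev : ∀ i, (C lam * h₁ * f - h₂ * g).eval (a i) = 0 := by
        intro i
        have h1 := (hxf i).symm.trans (hxg i)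
        have h2 : v i ^ 2 * f.eval (a i) =
            Lagrange.nodalWeight Finset.univ a i * g.eval (a i) := by
          have := congrArg (fun z => v i * z) h1
          field_simp [hv i] at this
          linear_combination this
        have h3 : Lagrange.nodalWeight Finset.univ a i *
            (lam * h₁.eval (a i) * f.eval (a i) - h₂.eval (a i) * g.eval (a i)) = 0 := by
          linear_combination h₂.eval (a i) * h2 - f.eval (a i) * hsq i
        have h4 := (mul_eq_zero.1 h3).resolve_left (hw i)
        simpa using h4
      have hnf : f.natDegree < k := by
        rw [degree_eq_natDegree hf0] at hf
        exact_mod_cast hf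
      have hd1 : (C lam * h₁ * f).degree < N := by
        rw [degree_eq_natDegree (mul_ne_zero (mul_ne_zero (C_ne_zero.2 hlam) h₁0) hf0),
          natDegree_mul (mul_ne_zero (C_ne_zero.2 hlam) h₁0) hf0, natDegree_C_mul hlam, hd₁]
        exact_mod_cast (by omega : N - k - 1 + f.natDegree < N)
      have hd2 : (h₂ * g).degree < N := by
        by_cases hg0 : g = 0
        · rw [hg0, mul_zero, degree_zero]
          exact WithBot.bot_lt_coe N
        rw [degree_eq_natDegree hg0] at hg
        have hg' : g.natDegree < N - k := by exact_mod_cast hg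
        rw [degree_eq_natDegree (mul_ne_zero h₂0 hg0), natDegree_mul h₂0 hg0]
        exact_mod_cast (by omega : h₂.natDegree + g.natDegree < N)
      have heq : C lam * h₁ * f = h₂ * g := by
        rw [← sub_eq_zero]
        exact eq_zero_of_eval_eq_zero ha
          ((degree_sub_le _ _).trans_lt (max_lt hd1 hd2)) hev
      have hdvd : h₂ ∣ f := by
        have : h₂ ∣ h₁ * (C lam * f) := ⟨g, by rw [← heq]; ring⟩
        have := hcop.symm.dvd_of_dvd_mul_left this
        rwa [(isUnit_C.2 (isUnit_iff_ne_zero.2 hlam)).dvd_mul_left] at this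
      obtain ⟨f', rfl⟩ := hdvd
      have hf'0 : f' ≠ 0 := right_ne_zero_of_mul hf0
      have hg' : g = C lam * h₁ * f' := by
        apply mul_left_cancel₀ h₂0
        rw [← heq]
        ring
      have hg0 : g ≠ 0 := by
        rw [hg']
        exact mul_ne_zero (mul_ne_zero (C_ne_zero.2 hlam) h₁0) hf'0
      rw [degree_eq_natDegree hg0] at hg
      have hgd : g.natDegree < N - k := by exact_mod_cast hg
      rw [hg', natDegree_mul (mul_ne_zero (C_ne_zero.2 hlam) h₁0) hf'0, natDegree_C_mul hlam,
        hd₁] at hgd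
      have hf'd : f'.natDegree = 0 := by omega
      rw [natDegree_eq_zero] at hf'd
      obtain ⟨c, rfl⟩ := hf'd
      refine ⟨c, ?_⟩
      ext i
      simp [hxf]
      ring
    · rintro ⟨c, rfl⟩
      refine ⟨⟨C c * h₂, ?_, fun i => ?_⟩, C (c * lam) * h₁, ?_, fun i => ?_⟩
      · refine degree_le_natDegree.trans_lt ?_
        have := (natDegree_C_mul_le c h₂).trans hd₂
        exact_mod_cast (by omega : (C c * h₂).natDegree < k)
      · simp
        ring
      · refine degree_le_natDegree.trans_lt ?_
        have := natDegree_C_mul_le (c * lam) h₁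
        exact_mod_cast (by omega : (C (c * lam) * h₁).natDegree < N - k)
      · have := hsq i
        simp only [Pi.smul_apply, weightedEval_apply, smul_eq_mul, eval_mul, eval_C]
        field_simp [hv i]
        linear_combination c * this
  rw [hspan]
  refine finrank_span_singleton fun h => ?_
  have := congrFun h i0
  simp [hv i0, he₂ i0] at this

/-- A set `A` of evaluation points together with polynomials `h₁`, `h₂` such that
`λ h₁(a) h₂(a) ∏_{b ≠ a} (a - b)` is a square for all `a ∈ A` yields a Reed–Solomon code with
one-dimensional hull; its dual has the same hull. -/
theorem exists_isOneDimHullMDS [DecidableEq F] {K : ℕ} (A : Finset F) (hA : A.card = N)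
    (hK1 : 1 ≤ K) (hK : K < N) {h₁ h₂ : F[X]} {lam : F} (hlam : lam ≠ 0)
    (hd₁ : h₁.natDegree = N - K - 1) (hd₂ : h₂.natDegree ≤ K - 1) (hcop : IsCoprime h₁ h₂)
    (he₁ : ∀ a ∈ A, h₁.eval a ≠ 0) (he₂ : ∀ a ∈ A, h₂.eval a ≠ 0)
    (hsq : ∀ a ∈ A, IsSquare (lam * h₁.eval a * h₂.eval a * ∏ b ∈ A.erase a, (a - b))) :
    (∃ C : Submodule F (Fin N → F), IsOneDimHullMDS C K) ∧
      (∃ C : Submodule F (Fin N → F), IsOneDimHullMDS C (N - K)) := by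
  let e := (A.equivFinOfCardEq hA).symm
  set a : Fin N → F := fun i => (e i : F) with ha_def
  have ha : Function.Injective a := Subtype.val_injective.comp e.injective
  have haA : ∀ i, a i ∈ A := fun i => (e i).2
  have hmap : A = Finset.univ.map ⟨a, ha⟩ := by
    symm
    apply Finset.eq_of_subset_of_card_le
    · intro x hx
      obtain ⟨i, -, rfl⟩ := Finset.mem_map.1 hx
      exact haA i
    · simp [hA]
  have hw : ∀ i, Lagrange.nodalWeight Finset.univ a i ≠ 0 := fun i =>
    Lagrange.nodalWeight_ne_zero ha.injOn (Finset.mem_univ i)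
  have hprod : ∀ i, ∏ b ∈ A.erase (a i), (a i - b) = (Lagrange.nodalWeight Finset.univ a i)⁻¹ := by
    intro i
    have h1 : A.erase (a i) = (Finset.univ.erase i).map ⟨a, ha⟩ := by
      rw [Finset.map_erase, ← hmap]
      rfl
    rw [h1, Finset.prod_map, Lagrange.nodalWeight, Finset.prod_inv_distrib, inv_inv]
    rfl
  choose t ht using fun i => hsq (a i) (haA i)
  have ht0 : ∀ i, t i ≠ 0 := by
    intro i h0
    have := ht i
    rw [h0, mul_zero, hprod] at this
    simp [hlam, he₁ _ (haA i), he₂ _ (haA i), hw i] at this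
  set v : Fin N → F := fun i =>
    t i * Lagrange.nodalWeight Finset.univ a i / h₂.eval (a i) with hv_def
  have hv : ∀ i, v i ≠ 0 := fun i =>
    div_ne_zero (mul_ne_zero (ht0 i) (hw i)) (he₂ _ (haA i))
  have hv2 : ∀ i, v i ^ 2 * h₂.eval (a i) =
      lam * h₁.eval (a i) * Lagrange.nodalWeight Finset.univ a i := by
    intro i
    have h1 := ht i
    have h2 := he₂ _ (haA i)
    have h3 := hw i
    rw [hprod] at h1
    have h4 : lam * h₁.eval (a i) * h₂.eval (a i) =
        t i * t i * Lagrange.nodalWeight Finset.univ a i := by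
      rw [← h1]
      field_simp
    simp only [hv_def]
    field_simp
    linear_combination -h4
  have hhull := finrank_hull_grs ha hv hK1 hK hlam hd₁ hd₂ hcop (fun i => he₁ _ (haA i))
    (fun i => he₂ _ (haA i)) hv2
  refine ⟨⟨grs a v K, finrank_grs ha hv hK.le, isMDS_grs ha hv hK1 hK.le, hhull⟩,
    dual (grs a v K), ?_, ?_, ?_⟩
  · rw [dual_grs ha hv hK.le]
    exact finrank_grs ha (fun i => div_ne_zero (hw i) (hv i)) (Nat.sub_le N K)
  · rw [dual_grs ha hv hK.le]
    exact isMDS_grs ha (fun i => div_ne_zero (hw i) (hv i)) (by omega) (Nat.sub_le N K)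
  · rw [hull, dual_dual_grs ha hv hK.le, inf_comm]
    exact hhull

/-! ### Point sets with square weights -/

/-- The possibilities for an even length `N`: there are `N` evaluation points `a` at which, up to
a common constant, `∏_{b ≠ a} (a - b)` is a square, or (for nonzero points) becomes one after
multiplication by `a`. -/
def HasSquareWeights (F : Type*) [Field F] [DecidableEq F] (N : ℕ) : Prop :=
  ∃ A : Finset F, A.card = N ∧ ∃ j : ℕ, (j = 0 ∨ j = 1 ∧ (0 : F) ∉ A) ∧ ∃ lam : F, lam ≠ 0 ∧
    ∀ a ∈ A, IsSquare (lam * a ^ j * ∏ b ∈ A.erase a, (a - b))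

lemma HasSquareWeights.of_isSquare_mul [DecidableEq F] {A : Finset F} {lam : F} (hA : A.card = N)
    (hlam : lam ≠ 0) (hsq : ∀ a ∈ A, IsSquare (lam * ∏ b ∈ A.erase a, (a - b))) :
    HasSquareWeights F N :=
  ⟨A, hA, 0, Or.inl rfl, lam, hlam, by simpa using hsq⟩

/-- Taking `h₁ = (X - c) ^ (2 * s)` for a point `c` off `A ∪ {0}` reduces the hull to dimension one
without affecting which weights are squares. -/
theorem HasSquareWeights.exists_isOneDimHullMDS [Fintype F] [DecidableEq F] {s : ℕ}
    (h : HasSquareWeights F N) (hN : N + 2 ≤ Fintype.card F) (hs : 2 * s + 4 ≤ N) :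
    (∃ C : Submodule F (Fin N → F), IsOneDimHullMDS C (N - 2 * s - 1)) ∧
      (∃ C : Submodule F (Fin N → F), IsOneDimHullMDS C (N - (N - 2 * s - 1))) := by
  obtain ⟨A, hA, j, hj, lam, hlam, hsq⟩ := h
  obtain ⟨c, hc⟩ : ∃ c, c ∉ insert 0 A := by
    by_contra! hcon
    have h1 : (Finset.univ : Finset F) ⊆ insert 0 A := fun x _ => hcon x
    have h2 := (Finset.card_le_card h1).trans (Finset.card_insert_le _ _)
    rw [Finset.card_univ, hA] at h2
    omega
  rw [Finset.mem_insert, not_or] at hc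
  refine LinearCode.exists_isOneDimHullMDS A hA (h₁ := (X - C c) ^ (2 * s)) (h₂ := X ^ j)
    (by omega) (by omega) hlam ?_ ?_ ?_ ?_ ?_ ?_
  · rw [natDegree_pow, natDegree_X_sub_C]
    omega
  · rw [natDegree_X_pow]
    omega
  · refine IsCoprime.pow ?_
    have := isCoprime_X_sub_C_of_isUnit_sub (R := F) (a := c) (b := 0)
      (by simpa using isUnit_iff_ne_zero.2 hc.1)
    simpa using this
  · intro a ha
    rw [eval_pow, eval_sub, eval_X, eval_C]
    refine pow_ne_zero _ (sub_ne_zero.2 ?_)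
    rintro rfl
    exact hc.2 ha
  · intro a ha
    rcases hj with rfl | ⟨rfl, h0⟩
    · simp
    · rw [pow_one, eval_X]
      rintro rfl
      exact h0 ha
  · intro a ha
    obtain ⟨r, hr⟩ := hsq a ha
    refine ⟨r * (a - c) ^ s, ?_⟩
    simp only [eval_pow, eval_sub, eval_X, eval_C]
    rw [mul_comm 2 s, pow_mul]
    linear_combination ((a - c) ^ s) ^ 2 * hr

/-- An odd number of points for which `-∏_{b ≠ a} (a - b)` is always a square can be completed by
the point at infinity; the Möbius map `x ↦ 1 / (x - c)` then makes all points finite. -/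
theorem HasSquareWeights.of_odd_card [Fintype F] [DecidableEq F] {A : Finset F}
    (hA : A.card + 1 = N) (hN : Even N) (hlt : N ≤ Fintype.card F)
    (hsq : ∀ a ∈ A, IsSquare (-∏ b ∈ A.erase a, (a - b))) : HasSquareWeights F N := by
  obtain ⟨c, hc⟩ : ∃ c, c ∉ A := by
    by_contra! hcon
    have h1 : (Finset.univ : Finset F) ⊆ A := fun x _ => hcon x
    have h2 := Finset.card_le_card h1
    rw [Finset.card_univ] at h2
    omega
  have hne : ∀ a ∈ A, a - c ≠ 0 := fun a ha h => hc (by rwa [← sub_eq_zero.1 h])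
  have hinj : Function.Injective fun a : F => (a - c)⁻¹ := fun a b h => by
    simpa using h
  set φ : F ↪ F := ⟨fun a => (a - c)⁻¹, hinj⟩ with hφ
  have h0 : (0 : F) ∉ A.map φ := by
    rw [Finset.mem_map]
    rintro ⟨a, ha, h⟩
    exact hne a ha (inv_eq_zero.1 h)
  set Y : F := ∏ a ∈ A, (a - c)⁻¹ with hY
  have hY0 : Y ≠ 0 := Finset.prod_ne_zero_iff.2 fun a ha => inv_ne_zero (hne a ha)
  have hodd : Odd A.card := by
    rcases Nat.even_or_odd A.card with h | h
    · exact absurd hN (by rw [← hA, Nat.not_even_iff_odd]; exact h.add_one)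
    · exact h
  refine ⟨insert 0 (A.map φ), ?_, 0, Or.inl rfl, -Y, neg_ne_zero.2 hY0, ?_⟩
  · rw [Finset.card_insert_of_notMem h0, Finset.card_map, hA]
  intro y hy
  rw [pow_zero, mul_one]
  rcases Finset.mem_insert.1 hy with rfl | hy
  · rw [Finset.erase_insert h0, Finset.prod_map]
    have : ∏ x ∈ A, (0 - φ x) = -Y := by
      simp only [zero_sub, Finset.prod_neg, hodd.neg_one_pow, hφ, Function.Embedding.coeFn_mk]
      ring
    rw [this]
    exact ⟨Y, by ring⟩
  · obtain ⟨a, ha, rfl⟩ := Finset.mem_map.1 hy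
    have hne0 : φ a ≠ 0 := fun h => h0 (h ▸ hy)
    have hprod : ∏ b ∈ (insert 0 (A.map φ)).erase (φ a), (φ a - b) =
        φ a * ∏ b ∈ A.erase a, (φ a - φ b) := by
      rw [Finset.erase_insert_of_ne hne0.symm, Finset.prod_insert, sub_zero, ← Finset.map_erase,
        Finset.prod_map]
      exact fun h => h0 (Finset.mem_of_mem_erase h)
    obtain ⟨k, hk⟩ := hodd
    have hcard : (A.erase a).card = 2 * k := by rw [Finset.card_erase_of_mem ha, hk]; omega
    have hprod2 : ∏ b ∈ A.erase a, (φ a - φ b) =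
        (φ a) ^ (2 * k) * (∏ b ∈ A.erase a, (b - c)⁻¹) * ∏ b ∈ A.erase a, (a - b) := by
      have h1 : ∀ b ∈ A.erase a, φ a - φ b = -(φ a * (b - c)⁻¹ * (a - b)) := by
        intro b hb
        have hb' := hne b (Finset.mem_of_mem_erase hb)
        have ha' := hne a ha
        simp only [hφ, Function.Embedding.coeFn_mk]
        field_simp
        ring
      rw [Finset.prod_congr rfl h1, Finset.prod_neg, hcard, (even_two_mul k).neg_one_pow, one_mul,
        Finset.prod_mul_distrib, Finset.prod_mul_distrib, Finset.prod_const, hcard]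
    have hYa : φ a * ∏ b ∈ A.erase a, (b - c)⁻¹ = Y := Finset.mul_prod_erase A _ ha
    obtain ⟨r, hr⟩ := hsq a ha
    refine ⟨Y * (φ a) ^ k * r, ?_⟩
    rw [hprod, hprod2]
    linear_combination Y * (φ a) ^ (2 * k) * (Y * hr) -
      Y * (φ a) ^ (2 * k) * (∏ b ∈ A.erase a, (a - b)) * hYa

end ReedSolomon

section FiniteField

variable {F : Type*} [Field F] [Fintype F]

/-! ### Squares in subfields -/

section Squares

variable {p m : ℕ}

/-- The fixed field of `x ↦ x ^ (p ^ r)` consists of squares when its degree `r` divides `m / 2`: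
it lies in the subfield of index two. -/
lemma isSquare_of_pow_eq_self (hF : Fintype.card F = p ^ m) (h2 : ringChar F ≠ 2) (hm : Even m)
    {r : ℕ} (hr : r ∣ m / 2) {y : F} (hy : y ^ p ^ r = y) : IsSquare y := by
  by_cases hy0 : y = 0
  · rw [hy0]
    exact IsSquare.zero
  obtain ⟨e, he⟩ := hr
  have hiter : ∀ k : ℕ, y ^ p ^ (r * k) = y := by
    intro k
    induction k with
    | zero => simp
    | succ k ih => rw [Nat.mul_succ, pow_add, pow_mul, ih, hy]
  have h1 := hiter e
  rw [← he] at h1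
  set Q := p ^ (m / 2) with hQ
  have hcard : Fintype.card F = Q * Q := by
    rw [hF, hQ, ← pow_add]
    congr 1
    obtain ⟨k, rfl⟩ := hm
    omega
  have hodd : Odd Q := by
    have := FiniteField.odd_card_of_char_ne_two h2
    rw [hcard] at this
    exact (Nat.odd_mul.1 (Nat.odd_iff.2 this)).1
  obtain ⟨k, hk⟩ := hodd
  have hpow : y ^ (2 * k) = 1 := by
    have : y ^ (2 * k) * y = 1 * y := by rw [← pow_succ, ← hk, h1, one_mul]
    exact mul_right_cancel₀ hy0 this
  rw [FiniteField.isSquare_iff h2 hy0, hcard, hk]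
  have : (2 * k + 1) * (2 * k + 1) / 2 = 2 * k * (k + 1) := by
    have : (2 * k + 1) * (2 * k + 1) = 2 * (2 * k * (k + 1)) + 1 := by ring
    omega
  rw [this, pow_mul, hpow, one_pow]

lemma isSquare_neg_one_of_even (hF : Fintype.card F = p ^ m) (h2 : ringChar F ≠ 2)
    (hm : Even m) : IsSquare (-1 : F) := by
  have hodd : Odd p := by
    have := FiniteField.odd_card_of_char_ne_two h2
    rw [hF] at this
    by_contra h
    rw [Nat.not_odd_iff_even] at h
    rcases Nat.eq_zero_or_pos m with rfl | hm0
    · have := Fintype.one_lt_card (α := F)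
      simp [hF] at this
    · have := Even.pow_of_ne_zero h hm0.ne'
      rw [Nat.even_iff] at this
      omega
  exact isSquare_of_pow_eq_self hF h2 hm (one_dvd _) (by rw [pow_one, hodd.neg_one_pow])

end Squares

/-! ### Unions of cosets of a subspace -/

section Cosets

/-- Pairing `h` with `-h` shows that the product of the nonzero elements of a finite subgroup is a
square as soon as `-1` is one. -/
lemma isSquare_prod_of_neg_mem (h2 : ringChar F ≠ 2) (hneg : IsSquare (-1 : F)) {S : Finset F}
    (hS0 : (0 : F) ∉ S) (hS : ∀ x ∈ S, -x ∈ S) : IsSquare (∏ x ∈ S, x) := by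
  classical
  have hne : ∏ x ∈ S, x ≠ 0 := Finset.prod_ne_zero_iff.2 fun x hx h => hS0 (h ▸ hx)
  rw [← quadraticChar_one_iff_isSquare hne, map_prod]
  have hχ : quadraticChar F (-1) = 1 :=
    (quadraticChar_one_iff_isSquare (neg_ne_zero.2 one_ne_zero)).2 hneg
  refine Finset.prod_involution (fun x _ => -x) ?_ ?_ (fun x hx => hS x hx) (fun x _ => neg_neg x)
  · intro x hx
    have hx0 : x ≠ 0 := fun h => hS0 (h ▸ hx)
    rw [neg_eq_neg_one_mul x, map_mul, hχ, one_mul, ← sq, quadraticChar_sq_one hx0]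
  · intro x hx _ hxx
    have hx0 : x ≠ 0 := fun h => hS0 (h ▸ hx)
    have h3 : (2 : F) * x = 0 := by linear_combination -hxx
    exact (mul_ne_zero (Ring.two_ne_zero h2) hx0) h3

/-- For a subspace `H` over a subfield `R`, a vector `e ∉ H` and `T ⊆ R`, let `A` be the union of
the cosets `c e + H` with `c ∈ T`. The differences `a - b` fill `H \ {0}` and the cosets
`(c - c') (e + H)`, so their product is, up to a fixed factor, a product of elements `c - c'`. -/
lemma exists_isSquare_prod_sub_of_submodule [DecidableEq F] {R : Type*} [Field R] [DecidableEq R]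
    [Algebra R F] (h2 : ringChar F ≠ 2) (hneg : IsSquare (-1 : F)) (H : Submodule R F) {e : F}
    (he : e ∉ H) (T : Finset R)
    (hT : ∀ c ∈ T, ∀ c' ∈ T, IsSquare (algebraMap R F (c - c'))) :
    ∃ A : Finset F, A.card = T.card * Nat.card H ∧ ∃ E : F, E ≠ 0 ∧
      ∀ a ∈ A, IsSquare (E ^ (T.card - 1) * ∏ b ∈ A.erase a, (a - b)) := by
  classical
  set S : Finset F := Finset.univ.filter fun x => x ∈ H with hS
  have hmem : ∀ x, x ∈ S ↔ x ∈ H := fun x => by simp [hS]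
  have hScard : S.card = Nat.card H := by
    rw [Nat.card_eq_fintype_card]
    exact (Fintype.card_of_subtype S hmem).symm
  have hsmul : ∀ c : R, c ≠ 0 → ∀ h ∈ H, c • e + h ≠ 0 := by
    intro c hc h hh h0
    apply he
    have : c • e ∈ H := by
      rw [eq_neg_of_add_eq_zero_left h0]
      exact H.neg_mem hh
    exact (H.smul_mem_iff hc).1 this
  have hinj : Function.Injective fun x : R × H => x.1 • e + (x.2 : F) := by
    rintro ⟨c, h⟩ ⟨c', h'⟩ hx
    have h1 : (c - c') • e + ((h - h' : H) : F) = 0 := by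
      have : c • e + (h : F) = c' • e + (h' : F) := hx
      rw [sub_smul, Submodule.coe_sub]
      linear_combination this
    have hc : c = c' := by
      by_contra hc
      exact hsmul _ (sub_ne_zero.2 hc) _ (h - h').2 h1
    subst hc
    rw [sub_self, zero_smul, zero_add] at h1
    rw [Prod.mk.injEq]
    exact ⟨rfl, sub_eq_zero.1 (Subtype.ext h1)⟩
  set f : R × F → F := fun x => x.1 • e + x.2 with hf
  have hinjOn : Set.InjOn f (T ×ˢ S : Finset (R × F)) := by
    rintro ⟨c, h⟩ hx ⟨c', h'⟩ hx' hxx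
    simp only [Finset.coe_product, Set.mem_prod, Finset.mem_coe, hmem] at hx hx'
    have := @hinj (c, ⟨h, hx.2⟩) (c', ⟨h', hx'.2⟩) hxx
    simpa using this
  set E : F := ∏ h ∈ S, (e + h) with hE
  have hE0 : E ≠ 0 := by
    refine Finset.prod_ne_zero_iff.2 fun h hh => ?_
    have := hsmul 1 one_ne_zero h ((hmem h).1 hh)
    rwa [one_smul] at this
  refine ⟨(T ×ˢ S).image f, ?_, E, hE0, ?_⟩
  · rw [Finset.card_image_of_injOn hinjOn, Finset.card_product, hScard]
  intro a ha
  obtain ⟨⟨c, h⟩, hch, rfl⟩ := Finset.mem_image.1 ha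
  rw [Finset.mem_product] at hch
  obtain ⟨hc, hh⟩ := hch
  simp only at hc hh
  -- `g` replaces the vanishing factor `a - a` by `1`, so that the product runs over a product set
  set g : F → F := fun x => if x = 0 then 1 else x with hg
  have h1 : ∏ b ∈ ((T ×ˢ S).image f).erase (f (c, h)), (f (c, h) - b) =
      ∏ b ∈ (T ×ˢ S).image f, g (f (c, h) - b) := by
    rw [← Finset.mul_prod_erase _ _ ha]
    have : g (f (c, h) - f (c, h)) = 1 := by simp [hg]
    rw [this, one_mul]
    refine Finset.prod_congr rfl fun b hb => ?_
    have : f (c, h) - b ≠ 0 := sub_ne_zero.2 (Finset.ne_of_mem_erase hb).symm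
    simp [hg, this]
  have hshift : ∀ c', ∏ h' ∈ S, g (f (c, h) - f (c', h')) = ∏ h' ∈ S, g ((c - c') • e + h') := by
    intro c'
    refine Finset.prod_bij' (fun x _ => h - x) (fun x _ => h - x) ?_ ?_ ?_ ?_ ?_
    · intro x hx
      rw [hmem] at hx hh ⊢
      exact H.sub_mem hh hx
    · intro x hx
      rw [hmem] at hx hh ⊢
      exact H.sub_mem hh hx
    · intro x _
      exact sub_sub_cancel h x
    · intro x _
      exact sub_sub_cancel h x
    · intro x _
      congr 1
      simp only [hf, sub_smul]
      ring
  have hκ : IsSquare (∏ h' ∈ S, g ((c - c) • e + h')) := by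
    have h0 : (0 : F) ∈ S := (hmem 0).2 H.zero_mem
    have : ∏ h' ∈ S, g ((c - c) • e + h') = ∏ x ∈ S.erase 0, x := by
      rw [← Finset.mul_prod_erase _ _ h0]
      simp only [sub_self, zero_smul, zero_add]
      rw [show g 0 = 1 by simp [hg], one_mul]
      refine Finset.prod_congr rfl fun b hb => ?_
      simp [hg, Finset.ne_of_mem_erase hb]
    rw [this]
    refine isSquare_prod_of_neg_mem h2 hneg (Finset.notMem_erase 0 S) fun x hx => ?_
    rw [Finset.mem_erase, hmem] at hx ⊢
    exact ⟨neg_ne_zero.2 hx.1, H.neg_mem hx.2⟩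
  have hother : ∀ c' ∈ T.erase c, ∏ h' ∈ S, g ((c - c') • e + h') =
      algebraMap R F (c - c') ^ S.card * E := by
    intro c' hc'
    have hcc : c - c' ≠ 0 := sub_ne_zero.2 (Finset.ne_of_mem_erase hc').symm
    have hstep : ∏ h' ∈ S, g ((c - c') • e + h') =
        ∏ h' ∈ S, algebraMap R F (c - c') * (e + h') := by
      refine Finset.prod_bij' (fun x _ => (c - c')⁻¹ • x) (fun x _ => (c - c') • x) ?_ ?_ ?_ ?_ ?_
      · intro x hx
        rw [hmem] at hx ⊢
        exact H.smul_mem _ hx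
      · intro x hx
        rw [hmem] at hx ⊢
        exact H.smul_mem _ hx
      · intro x _
        exact smul_inv_smul₀ hcc x
      · intro x _
        exact inv_smul_smul₀ hcc x
      · intro x hx
        have := hsmul _ hcc x ((hmem x).1 hx)
        rw [← Algebra.smul_def, smul_add, smul_inv_smul₀ hcc]
        simp [hg, this]
    rw [hstep, Finset.prod_mul_distrib, Finset.prod_const]
  rw [h1, Finset.prod_image hinjOn, Finset.prod_product,
    Finset.prod_congr rfl fun c' _ => hshift c',
    ← Finset.mul_prod_erase _ _ hc, Finset.prod_congr rfl hother, Finset.prod_mul_distrib,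
    Finset.prod_const, Finset.card_erase_of_mem hc]
  have hT' : IsSquare (∏ c' ∈ T.erase c, algebraMap R F (c - c') ^ S.card) := by
    rw [Finset.prod_pow]
    refine IsSquare.pow _ (Finset.isSquare_prod _ fun c' hc' => ?_)
    exact hT c hc c' (Finset.mem_of_mem_erase hc')
  have hEE : IsSquare (E ^ (T.card - 1) * E ^ (T.card - 1)) := ⟨_, rfl⟩
  have := (hκ.mul hT').mul hEE
  convert! this using 1
  ring

/-- A subspace of any dimension below the maximal one, and a vector outside it. -/
lemma exists_submodule_natCard_eq {R : Type*} [Field R] [Algebra R F] {l : ℕ}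
    (hl : l < Module.finrank R F) :
    ∃ (H : Submodule R F) (e : F), e ∉ H ∧ Nat.card H = Nat.card R ^ l := by
  have : Finite R := Finite.of_injective _ (algebraMap R F).injective
  let b := Module.finBasis R F
  have hli : LinearIndependent R fun i : Fin l => b (Fin.castLE hl.le i) :=
    b.linearIndependent.comp _ (Fin.castLE_injective hl.le)
  refine ⟨Submodule.span R (Set.range fun i : Fin l => b (Fin.castLE hl.le i)), b ⟨l, hl⟩, ?_, ?_⟩
  · have : (Set.range fun i : Fin l => b (Fin.castLE hl.le i)) =
        b '' Set.range (Fin.castLE hl.le) := by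
      rw [← Set.range_comp]
      rfl
    rw [this]
    refine b.linearIndependent.notMem_span_image ?_
    rintro ⟨i, hi⟩
    have h1 := congrArg Fin.val hi
    have h2 := i.2
    simp only [Fin.val_castLE] at h1
    omega
  · rw [Module.natCard_eq_pow_finrank (K := R), finrank_span_eq_card hli, Fintype.card_fin]

/-- Unions of cosets indexed by a subfield of order `p ^ m₀` all of whose elements are squares. -/
lemma exists_isSquare_prod_sub_of_subfield [DecidableEq F] {p m m₀ l t : ℕ} (hp : p.Prime)
    (hF : Fintype.card F = p ^ m) (h2 : ringChar F ≠ 2) (hm : Even m) (hm₀ : m₀ ∣ m / 2)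
    (hl : l < m / m₀) (ht : t ≤ p ^ m₀) :
    ∃ A : Finset F, A.card = t * (p ^ m₀) ^ l ∧ ∃ E : F, E ≠ 0 ∧
      ∀ a ∈ A, IsSquare (E ^ (t - 1) * ∏ b ∈ A.erase a, (a - b)) := by
  classical
  have hm₀0 : m₀ ≠ 0 := by
    rintro rfl
    simp at hl
  have : Fact p.Prime := ⟨hp⟩
  have hchar : CharP F p := charP_of_card_eq_prime_pow hF
  let := ZMod.algebra F p
  have hdvd : m₀ ∣ m := by
    obtain ⟨k, hk⟩ := hm₀
    obtain ⟨j, rfl⟩ := hm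
    exact ⟨2 * k, by rw [show m₀ * (2 * k) = 2 * (m₀ * k) by ring, ← hk]; omega⟩
  have hfin : Module.finrank (ZMod p) F = m := by
    have h1 := FiniteField.pow_finrank_eq_card p F
    rw [hF] at h1
    exact Nat.pow_right_injective hp.two_le h1
  obtain ⟨ι⟩ : Nonempty (GaloisField p m₀ →ₐ[ZMod p] F) :=
    FiniteField.nonempty_algHom_of_finrank_dvd (by rwa [GaloisField.finrank p hm₀0, hfin])
  let := ι.toRingHom.toAlgebra
  have hR : Nat.card (GaloisField p m₀) = p ^ m₀ := GaloisField.card p m₀ hm₀0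
  have : Fintype (GaloisField p m₀) := Fintype.ofFinite _
  have hR' : Fintype.card (GaloisField p m₀) = p ^ m₀ := by
    rw [← Nat.card_eq_fintype_card, hR]
  have hfin' : Module.finrank (GaloisField p m₀) F = m / m₀ := by
    have h1 := Module.natCard_eq_pow_finrank (K := GaloisField p m₀) (V := F)
    rw [Nat.card_eq_fintype_card, hF, hR, ← pow_mul] at h1
    have h3 := Nat.pow_right_injective hp.two_le h1
    rw [h3, Nat.mul_div_cancel_left _ (Nat.pos_of_ne_zero hm₀0)]
  obtain ⟨H, e, he, hH⟩ := exists_submodule_natCard_eq (R := GaloisField p m₀) (F := F)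
    (hfin' ▸ hl)
  obtain ⟨T, -, hT⟩ := Finset.exists_subset_card_eq
    (s := (Finset.univ : Finset (GaloisField p m₀))) (n := t) (by rwa [Finset.card_univ, hR'])
  obtain ⟨A, hA, E, hE, hsq⟩ := exists_isSquare_prod_sub_of_submodule h2
    (isSquare_neg_one_of_even hF h2 hm) H he T fun c _ c' _ =>
      isSquare_of_pow_eq_self hF h2 hm hm₀ (by
        rw [← map_pow, ← hR', FiniteField.pow_card])
  rw [hT] at hsq hA
  rw [hH, hR] at hA
  exact ⟨A, hA, E, hE, hsq⟩

/-- One or two cosets of a subspace over the prime field, when `-1` is a square. -/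
lemma exists_isSquare_prod_sub_of_primeField [DecidableEq F] {p m l t : ℕ} (hp : p.Prime)
    (hF : Fintype.card F = p ^ m) (h2 : ringChar F ≠ 2) (hneg : IsSquare (-1 : F))
    (hl : l < m) (ht : t ≤ 2) :
    ∃ A : Finset F, A.card = t * p ^ l ∧ ∃ E : F, E ≠ 0 ∧
      ∀ a ∈ A, IsSquare (E ^ (t - 1) * ∏ b ∈ A.erase a, (a - b)) := by
  classical
  have : Fact p.Prime := ⟨hp⟩
  have hchar : CharP F p := charP_of_card_eq_prime_pow hF
  let := ZMod.algebra F p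
  have hfin : Module.finrank (ZMod p) F = m := by
    have h1 := FiniteField.pow_finrank_eq_card p F
    rw [hF] at h1
    exact Nat.pow_right_injective hp.two_le h1
  obtain ⟨H, e, he, hH⟩ := exists_submodule_natCard_eq (R := ZMod p) (F := F) (hfin.symm ▸ hl)
  obtain ⟨T, hT', hT⟩ := Finset.exists_subset_card_eq
    (s := ({0, 1} : Finset (ZMod p))) (n := t) (by rwa [Finset.card_pair zero_ne_one])
  obtain ⟨A, hA, E, hE, hsq⟩ := exists_isSquare_prod_sub_of_submodule h2 hneg H he T (by
    intro c hc c' hc'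
    have h1 := hT' hc
    have h1' := hT' hc'
    simp only [Finset.mem_insert, Finset.mem_singleton] at h1 h1'
    rcases h1 with rfl | rfl <;> rcases h1' with rfl | rfl <;> simp [hneg])
  rw [hT] at hsq hA
  rw [hH, Nat.card_zmod] at hA
  exact ⟨A, hA, E, hE, hsq⟩

/-- An odd number of cosets, together with the point at infinity. -/
lemma HasSquareWeights.of_cosets_add_one [DecidableEq F] {N t : ℕ} (hneg : IsSquare (-1 : F))
    (ht : Odd t) (hN : Even (N + 1)) (hlt : N + 1 ≤ Fintype.card F)
    (h : ∃ A : Finset F, A.card = N ∧ ∃ E : F, E ≠ 0 ∧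
      ∀ a ∈ A, IsSquare (E ^ (t - 1) * ∏ b ∈ A.erase a, (a - b))) :
    HasSquareWeights F (N + 1) := by
  obtain ⟨A, hA, E, hE, hsq⟩ := h
  refine HasSquareWeights.of_odd_card (A := A) (by rw [hA]) hN hlt fun a ha => ?_
  obtain ⟨r, hr⟩ := hsq a ha
  obtain ⟨i, hi⟩ := hneg
  obtain ⟨k, rfl⟩ := ht
  have hEk : E ^ k ≠ 0 := pow_ne_zero _ hE
  refine ⟨i * r / E ^ k, ?_⟩
  rw [show 2 * k + 1 - 1 = k + k by omega, pow_add] at hr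
  field_simp
  linear_combination -hr + r ^ 2 * hi

end Cosets

/-! ### Roots of divisors of `X ^ q - X` -/

section Nodal

variable {F : Type*} [Field F]

lemma prod_sub_eq_of_nodal_eq [DecidableEq F] {A : Finset F} {P : F[X]}
    (hA : Lagrange.nodal A id = P) {a : F} (ha : a ∈ A) :
    ∏ b ∈ A.erase a, (a - b) = (derivative P).eval a := by
  have := Lagrange.eval_nodal_derivative_eval_node_eq (v := id) ha
  rw [id, hA, Lagrange.eval_nodal] at this
  exact this.symm

lemma mem_iff_of_nodal_eq {A : Finset F} {P : F[X]} (hA : Lagrange.nodal A id = P) {a : F} :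
    a ∈ A ↔ P.eval a = 0 := by
  rw [← hA, Lagrange.eval_nodal, Finset.prod_eq_zero_iff]
  simp [sub_eq_zero]

lemma card_eq_of_nodal_eq {A : Finset F} {P : F[X]} (hA : Lagrange.nodal A id = P) :
    A.card = P.natDegree := by
  rw [← hA, Lagrange.natDegree_nodal]

end Nodal

/-! ### Unions of cosets of roots of unity -/

section Multiplicative

/-- A monic divisor of `X ^ q - X` is the nodal polynomial of its set of roots. -/
lemma exists_nodal_eq {P : F[X]} (hP : P.Monic) (hdvd : P ∣ X ^ Fintype.card F - X) :
    ∃ A : Finset F, Lagrange.nodal A id = P := by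
  classical
  have hne : (X ^ Fintype.card F - X : F[X]) ≠ 0 :=
    FiniteField.X_pow_card_sub_X_ne_zero F Fintype.one_lt_card
  have hfull : (X ^ Fintype.card F - X : F[X]).Splits := by
    rw [splits_iff_card_roots, FiniteField.roots_X_pow_card_sub_X,
      FiniteField.X_pow_card_sub_X_natDegree_eq F Fintype.one_lt_card]
    rfl
  have hsplit : P.Splits := hfull.of_dvd hne hdvd
  have hnodup : P.roots.Nodup := by
    have h1 := roots.le_of_dvd hne hdvd
    rw [FiniteField.roots_X_pow_card_sub_X] at h1
    exact Multiset.nodup_of_le h1 Finset.univ.nodup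
  refine ⟨⟨P.roots, hnodup⟩, ?_⟩
  rw [Lagrange.nodal_eq]
  exact (hsplit.eq_prod_roots_of_monic hP).symm

/-- The roots of `X ^ N - X`, that is `0` and the `(N - 1)`-st roots of unity: the derivative
`N X ^ (N - 1) - 1` is `-1` at the former and `N - 1` at the latter. -/
lemma HasSquareWeights.of_sub_one_dvd [DecidableEq F] {N : ℕ} (hN : 2 ≤ N)
    (hdvd : N - 1 ∣ Fintype.card F - 1) {lam : F} (hlam : lam ≠ 0) (h0 : IsSquare (lam * -1))
    (h1 : IsSquare (lam * ((N : F) - 1))) : HasSquareWeights F N := by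
  have hq : 1 < Fintype.card F := Fintype.one_lt_card
  have hmonic : (X ^ N - X : F[X]).Monic := by
    refine monic_X_pow_sub ?_
    rw [degree_X]
    exact_mod_cast (by omega : 1 < N)
  have hsplit : ∀ k, 1 ≤ k → (X ^ k - X : F[X]) = X * (X ^ (k - 1) - 1) := by
    intro k hk
    obtain ⟨k, rfl⟩ := Nat.exists_eq_add_of_le' hk
    rw [Nat.add_sub_cancel]
    ring
  have hd : (X ^ N - X : F[X]) ∣ X ^ Fintype.card F - X := by
    rw [hsplit N (by omega), hsplit _ hq.le]
    exact mul_dvd_mul_left _ (dvd_pow_sub_one_of_dvd hdvd)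
  obtain ⟨A, hA⟩ := exists_nodal_eq hmonic hd
  refine .of_isSquare_mul (A := A) (lam := lam) ?_ hlam fun a ha => ?_
  · rw [card_eq_of_nodal_eq hA, FiniteField.X_pow_card_sub_X_natDegree_eq F (by omega)]
  · rw [prod_sub_eq_of_nodal_eq hA ha]
    rw [mem_iff_of_nodal_eq hA, hsplit N (by omega)] at ha
    simp only [eval_mul, eval_X, eval_sub, eval_pow, eval_one, mul_eq_zero] at ha
    simp only [derivative_sub, derivative_X_pow, derivative_X, eval_sub, eval_mul, eval_C, eval_pow,
      eval_X, eval_one]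
    rcases ha with rfl | ha
    · rw [zero_pow (by omega), mul_zero, zero_sub]
      exact h0
    · rw [sub_eq_zero.1 ha, mul_one]
      exact h1

/-- Unions of `T` cosets of the group of `n`-th roots of unity, described by their images `B` under
the `n`-th power map. -/
lemma exists_union_cosets_rootsOfUnity [DecidableEq F] {n k T : ℕ}
    (hnk : n * k = Fintype.card F - 1) (hT : T ≤ k) :
    ∃ B A : Finset F, B.card = T ∧ A.card = n * T ∧ (∀ b ∈ B, b ^ k = 1) ∧
      ∀ a ∈ A, a ^ n ∈ B ∧
        ∏ b ∈ A.erase a, (a - b) = n * a ^ (n - 1) * ∏ b ∈ B.erase (a ^ n), (a ^ n - b) := by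
  have hq : 1 < Fintype.card F := Fintype.one_lt_card
  have hn0 : n ≠ 0 := by
    rintro rfl
    omega
  have hk0 : k ≠ 0 := by
    rintro rfl
    omega
  have hfull : (X ^ (Fintype.card F - 1) - 1 : F[X]) ∣ X ^ Fintype.card F - X := by
    refine ⟨X, ?_⟩
    rw [sub_mul, one_mul, ← pow_succ, Nat.sub_add_cancel hq.le]
  have hmonic : (X ^ k - 1 : F[X]).Monic := by
    simpa using monic_X_pow_sub_C (1 : F) hk0
  obtain ⟨U, hU⟩ := exists_nodal_eq hmonic
    ((dvd_pow_sub_one_of_dvd ⟨n, by rw [← hnk, mul_comm]⟩).trans hfull)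
  have hUcard : U.card = k := by
    rw [card_eq_of_nodal_eq hU]
    simpa using natDegree_X_pow_sub_C (n := k) (r := (1 : F))
  obtain ⟨B, hBU, hB⟩ := Finset.exists_subset_card_eq (s := U) (n := T) (by rwa [hUcard])
  have hPmonic : ((Lagrange.nodal B id).comp (X ^ n) : F[X]).Monic :=
    Lagrange.nodal_monic.comp (monic_X_pow n) (by rwa [natDegree_X_pow])
  have hPdvd : (Lagrange.nodal B id).comp (X ^ n) ∣ (X ^ Fintype.card F - X : F[X]) := by
    refine dvd_trans ?_ hfull
    obtain ⟨R, hR⟩ : Lagrange.nodal B id ∣ (X ^ k - 1 : F[X]) := by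
      rw [← hU, Lagrange.nodal_eq, Lagrange.nodal_eq]
      exact Finset.prod_dvd_prod_of_subset _ _ _ hBU
    refine ⟨R.comp (X ^ n), ?_⟩
    rw [← mul_comp, ← hR, sub_comp, X_pow_comp, one_comp, ← pow_mul, hnk]
  obtain ⟨A, hA⟩ := exists_nodal_eq hPmonic hPdvd
  refine ⟨B, A, hB, ?_, fun b hb => ?_, fun a ha => ?_⟩
  · rw [card_eq_of_nodal_eq hA, natDegree_comp, Lagrange.natDegree_nodal, hB, natDegree_X_pow,
      mul_comm]
  · have := (mem_iff_of_nodal_eq hU).1 (hBU hb)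
    simpa [sub_eq_zero] using this
  · have haB : a ^ n ∈ B := by
      rw [mem_iff_of_nodal_eq hA, eval_comp, eval_pow, eval_X] at ha
      exact (mem_iff_of_nodal_eq rfl).2 ha
    refine ⟨haB, ?_⟩
    rw [prod_sub_eq_of_nodal_eq hA ha, prod_sub_eq_of_nodal_eq rfl haB, derivative_comp,
      derivative_X_pow, eval_mul, eval_comp]
    simp

lemma natCast_ne_zero_of_mul_eq {n k : ℕ} (hnk : n * k = Fintype.card F - 1) : (n : F) ≠ 0 := by
  intro h
  have h1 : ((n * k : ℕ) : F) = 0 := by rw [Nat.cast_mul, h, zero_mul]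
  rw [hnk, Nat.cast_sub Fintype.one_lt_card.le, FiniteField.cast_card_eq_zero] at h1
  simp at h1

/-- On a coset `a ^ N = b` of the `N`-th roots of unity, `a * ∏_{b ≠ a} (a - b)` is constant. -/
lemma HasSquareWeights.of_dvd_sub_one [DecidableEq F] {N : ℕ} (hdvd : N ∣ Fintype.card F - 1) :
    HasSquareWeights F N := by
  obtain ⟨k, hk⟩ := hdvd
  have hq : 1 < Fintype.card F := Fintype.one_lt_card
  have hk0 : k ≠ 0 := by
    rintro rfl
    omega
  have hN0 : N ≠ 0 := by
    rintro rfl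
    omega
  obtain ⟨B, A, hB, hA, hBk, hAB⟩ := exists_union_cosets_rootsOfUnity hk.symm
    (Nat.one_le_iff_ne_zero.2 hk0)
  obtain ⟨b, rfl⟩ := Finset.card_eq_one.1 hB
  have hb0 : b ≠ 0 := by
    rintro rfl
    simpa [hk0] using hBk 0 (Finset.mem_singleton_self 0)
  refine ⟨A, by rw [hA, mul_one], 1, Or.inr ⟨rfl, fun h0 => ?_⟩, N * b,
    mul_ne_zero (natCast_ne_zero_of_mul_eq hk.symm) hb0, fun a ha => ?_⟩
  · have := (hAB 0 h0).1
    rw [zero_pow hN0, Finset.mem_singleton] at this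
    exact hb0 this.symm
  · obtain ⟨h1, h2⟩ := hAB a ha
    rw [Finset.mem_singleton] at h1
    refine ⟨N * b, ?_⟩
    rw [h2, h1, Finset.erase_singleton, Finset.prod_empty, pow_one, mul_one]
    have : a * a ^ (N - 1) = b := by rw [← pow_succ', Nat.sub_add_cancel (by omega), h1]
    linear_combination N ^ 2 * b * this

/-- For odd `N ∣ q - 1`, the polynomial `h₁ = X ^ (2 * s + 1)` has the parity needed to compensate
the factor `a ^ (N - 1)` in `∏_{b ≠ a} (a - b) = N a ^ (N - 1)`. -/
theorem exists_isOneDimHullMDS_of_odd [DecidableEq F] {N s : ℕ} (hdvd : N ∣ Fintype.card F - 1)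
    (hN : Odd N) (hs : 2 * s + 5 ≤ N) :
    (∃ C : Submodule F (Fin N → F), IsOneDimHullMDS C (N - 2 * s - 2)) ∧
      (∃ C : Submodule F (Fin N → F), IsOneDimHullMDS C (N - (N - 2 * s - 2))) := by
  obtain ⟨k, hk⟩ := hdvd
  have hq : 1 < Fintype.card F := Fintype.one_lt_card
  have hk0 : k ≠ 0 := by
    rintro rfl
    omega
  obtain ⟨B, A, hB, hA, hBk, hAB⟩ := exists_union_cosets_rootsOfUnity hk.symm
    (Nat.one_le_iff_ne_zero.2 hk0)
  obtain ⟨b, rfl⟩ := Finset.card_eq_one.1 hB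
  have hb0 : b ≠ 0 := by
    rintro rfl
    simpa [hk0] using hBk 0 (Finset.mem_singleton_self 0)
  refine exists_isOneDimHullMDS A (by rw [hA, mul_one]) (h₁ := X ^ (2 * s + 1)) (h₂ := 1)
    (lam := N * b) (by omega) (by omega)
    (mul_ne_zero (natCast_ne_zero_of_mul_eq hk.symm) hb0) ?_ ?_ isCoprime_one_right ?_ ?_ ?_
  · rw [natDegree_X_pow]
    obtain ⟨j, rfl⟩ := hN
    omega
  · simp
  · intro a ha
    rw [eval_pow, eval_X]
    refine pow_ne_zero _ ?_
    rintro rfl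
    have := (hAB 0 ha).1
    rw [zero_pow (by omega), Finset.mem_singleton] at this
    exact hb0 this.symm
  · simp
  · intro a ha
    obtain ⟨h1, h2⟩ := hAB a ha
    rw [Finset.mem_singleton] at h1
    refine ⟨N * b * a ^ s, ?_⟩
    rw [h2, h1, Finset.erase_singleton, Finset.prod_empty, eval_one, eval_pow, eval_X]
    have : a * a ^ (N - 1) = b := by rw [← pow_succ', Nat.sub_add_cancel (by omega), h1]
    linear_combination N ^ 2 * b * (a ^ s) ^ 2 * this

/-- Cosets whose images under the `n`-th power map lie in a subfield of order `Q = p ^ r` all of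
whose elements are squares. -/
lemma HasSquareWeights.of_mul_sub_one_eq [DecidableEq F] {p m r n T : ℕ} (hp : p.Prime)
    (hF : Fintype.card F = p ^ m) (h2 : ringChar F ≠ 2) (hm : Even m) (hr : r ∣ m / 2)
    (hn : n * (p ^ r - 1) = Fintype.card F - 1) (hT : T ≤ p ^ r - 1) :
    HasSquareWeights F (n * T) := by
  have : Fact p.Prime := ⟨hp⟩
  have hchar : CharP F p := charP_of_card_eq_prime_pow hF
  have hq : 1 < Fintype.card F := Fintype.one_lt_card
  have hQ0 : p ^ r - 1 ≠ 0 := by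
    intro h
    rw [h] at hn
    omega
  have hn0 : n ≠ 0 := by
    rintro rfl
    omega
  obtain ⟨B, A, hB, hA, hBk, hAB⟩ := exists_union_cosets_rootsOfUnity hn hT
  have hfix : ∀ b ∈ B, b ^ p ^ r = b := by
    intro b hb
    rw [← Nat.sub_add_cancel (Nat.one_le_pow r p hp.pos), pow_succ, hBk b hb, one_mul]
  refine ⟨A, hA, 1, Or.inr ⟨rfl, fun h0 => ?_⟩, 1, one_ne_zero, fun a ha => ?_⟩
  · have := hBk _ (hAB 0 h0).1
    rw [zero_pow hn0, zero_pow hQ0] at this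
    exact zero_ne_one this
  · obtain ⟨h1, h3⟩ := hAB a ha
    have h4 : (1 : F) * a ^ 1 * ∏ b ∈ A.erase a, (a - b) =
        n * a ^ n * ∏ b ∈ B.erase (a ^ n), (a ^ n - b) := by
      rw [h3, ← Nat.sub_add_cancel (Nat.one_le_iff_ne_zero.2 hn0), Nat.add_sub_cancel, pow_succ]
      ring
    rw [h4]
    refine ((?_ : IsSquare (n : F)).mul ?_).mul (Finset.isSquare_prod _ fun b hb => ?_)
    · refine isSquare_of_pow_eq_self hF h2 hm (one_dvd _) ?_
      rw [pow_one]
      exact map_natCast (frobenius F p) n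
    · exact isSquare_of_pow_eq_self hF h2 hm hr (hfix _ h1)
    · refine isSquare_of_pow_eq_self hF h2 hm hr ?_
      rw [sub_pow_char_pow, hfix _ h1, hfix _ (Finset.mem_of_mem_erase hb)]

/-- Elements with the same quadratic character become squares after a common scaling. -/
lemma exists_isSquare_mul_of_pow_eq (h2 : ringChar F ≠ 2) {ι : Type*} {A : Finset ι} {f : ι → F}
    {κ : F} (hf0 : ∀ a ∈ A, f a ≠ 0) (hf : ∀ a ∈ A, f a ^ (Fintype.card F / 2) = κ) :
    ∃ lam : F, lam ≠ 0 ∧ ∀ a ∈ A, IsSquare (lam * f a) := by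
  rcases A.eq_empty_or_nonempty with rfl | ⟨a₀, ha₀⟩
  · exact ⟨1, one_ne_zero, by simp⟩
  refine ⟨f a₀, hf0 a₀ ha₀, fun a ha => ?_⟩
  rw [FiniteField.isSquare_iff h2 (mul_ne_zero (hf0 a₀ ha₀) (hf0 a ha)), mul_pow, hf a ha,
    ← hf a₀ ha₀]
  rcases FiniteField.pow_dichotomy h2 (hf0 a₀ ha₀) with h | h <;> rw [h] <;> ring

/-- Cosets whose images `B` under the `n`-th power map have order dividing `Q + 1`, `Q = p ^ r`.
For distinct `x, y ∈ B` one has `(x - y) ^ (Q - 1) = -1 / (x y)`, so the quadratic character of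
`∏ (x - y)` at `x = a ^ n` is a constant times a power of the quadratic character of `a`. -/
lemma HasSquareWeights.of_mul_add_one_eq [DecidableEq F] {p m r n T c E : ℕ} (hp : p.Prime)
    (hF : Fintype.card F = p ^ m) (h2 : ringChar F ≠ 2)
    (hn : n * (p ^ r + 1) = Fintype.card F - 1) (hc : Fintype.card F / 2 = (p ^ r - 1) * c)
    (hE : n = (p ^ r - 1) * E) (hT1 : 1 ≤ T) (hT : T ≤ p ^ r + 1) :
    HasSquareWeights F (n * T) := by
  have : Fact p.Prime := ⟨hp⟩
  have hchar : CharP F p := charP_of_card_eq_prime_pow hF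
  have hq : 1 < Fintype.card F := Fintype.one_lt_card
  have hn0 : n ≠ 0 := by
    rintro rfl
    omega
  have hQ1 : 1 ≤ p ^ r := Nat.one_le_pow r p hp.pos
  obtain ⟨B, A, hB, hA, hBk, hAB⟩ := exists_union_cosets_rootsOfUnity hn hT
  have hB0 : ∀ b ∈ B, b ≠ 0 := by
    rintro b hb rfl
    simpa using hBk 0 hb
  have hA0 : ∀ a ∈ A, a ≠ 0 := by
    rintro a ha rfl
    exact hB0 _ (hAB 0 ha).1 (zero_pow hn0)
  set d := Fintype.card F / 2 with hd
  have hpair : ∀ x ∈ B, ∀ y ∈ B, x ≠ y → (x - y) ^ d * (x * y) ^ c = (-1) ^ c := by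
    intro x hx y hy hxy
    have hx1 := hBk x hx
    have hy1 := hBk y hy
    rw [pow_succ] at hx1 hy1
    have h1 : (x - y) ^ p ^ r = x ^ p ^ r - y ^ p ^ r := sub_pow_char_pow ..
    have h3 : (x - y) ^ (p ^ r - 1) * (x * y) = -1 := by
      apply mul_right_cancel₀ (sub_ne_zero.2 hxy)
      have h4 : (x - y) ^ (p ^ r - 1) * (x - y) = (x - y) ^ p ^ r := by
        rw [← pow_succ, Nat.sub_add_cancel hQ1]
      linear_combination x * y * h4 + x * y * h1 + y * hx1 - x * hy1
    rw [hc, pow_mul, ← mul_pow, h3]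
  -- the parity of the exponent of the character of `a` decides whether the factor `a` is needed
  set j := (n - 1 + E * T) % 2 with hj
  have hj01 : j = 0 ∨ j = 1 := by omega
  have hf0 : ∀ a ∈ A, a ^ j * ∏ b ∈ A.erase a, (a - b) ≠ 0 := by
    intro a ha
    refine mul_ne_zero (pow_ne_zero _ (hA0 a ha)) (Finset.prod_ne_zero_iff.2 fun b hb => ?_)
    exact sub_ne_zero.2 (Finset.ne_of_mem_erase hb).symm
  have hM0 : ∏ b ∈ B, b ^ c ≠ 0 :=
    Finset.prod_ne_zero_iff.2 fun b hb => pow_ne_zero _ (hB0 b hb)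
  have hconst : ∀ a ∈ A, (a ^ j * ∏ b ∈ A.erase a, (a - b)) ^ d =
      (n : F) ^ d * (-1) ^ (c * (T - 1)) / ∏ b ∈ B, b ^ c := by
    intro a ha
    obtain ⟨h1, h3⟩ := hAB a ha
    set χ := a ^ d with hχ
    have hχ2 : χ ^ 2 = 1 := by
      rcases FiniteField.pow_dichotomy h2 (hA0 a ha) with h | h <;> rw [hχ, hd, h] <;> ring
    have hχE : (a ^ n) ^ c = χ ^ E := by
      rw [hχ, ← pow_mul, ← pow_mul, hc, hE]
      congr 1
      ring
    have hχ0 : χ ≠ 0 := pow_ne_zero _ (hA0 a ha)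
    set D := ∏ b ∈ B.erase (a ^ n), (a ^ n - b) with hD
    have h4 : D ^ d * (χ ^ E) ^ (T - 1) * ∏ b ∈ B.erase (a ^ n), b ^ c = (-1) ^ (c * (T - 1)) := by
      have h5 : ∏ b ∈ B.erase (a ^ n), ((a ^ n - b) ^ d * (a ^ n * b) ^ c) =
          ∏ b ∈ B.erase (a ^ n), (-1) ^ c :=
        Finset.prod_congr rfl fun b hb =>
          hpair _ h1 b (Finset.mem_of_mem_erase hb) (Finset.ne_of_mem_erase hb).symm
      rw [Finset.prod_const, Finset.card_erase_of_mem h1, hB, ← pow_mul,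
        Finset.prod_mul_distrib, Finset.prod_pow] at h5
      simp only [mul_pow] at h5
      rw [Finset.prod_mul_distrib, Finset.prod_const, Finset.card_erase_of_mem h1, hB, hχE] at h5
      rw [← h5]
      ring
    have h6 : χ ^ E * ∏ b ∈ B.erase (a ^ n), b ^ c = ∏ b ∈ B, b ^ c := by
      rw [← hχE]
      exact Finset.mul_prod_erase B (fun b => b ^ c) h1
    have h7 : (χ ^ E) ^ (T - 1) * χ ^ E = χ ^ (E * T) := by
      rw [← pow_succ, Nat.sub_add_cancel hT1, pow_mul]
    have h8 : χ ^ (n - 1 + E * T + j) = 1 := by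
      have : n - 1 + E * T + j = 2 * ((n - 1 + E * T + j) / 2) := by omega
      rw [this, pow_mul, hχ2, one_pow]
    have h9 : χ ^ (E * T) * χ ^ (E * T) = 1 := by
      rw [← sq, ← pow_mul, mul_comm, pow_mul, hχ2, one_pow]
    have h10 : (χ ^ E) * (χ ^ E) = 1 := by
      rw [← sq, ← pow_mul, mul_comm, pow_mul, hχ2, one_pow]
    rw [h3, eq_div_iff hM0, ← h4, ← h6]
    have h11 : (a ^ j * (n * a ^ (n - 1) * D)) ^ d = (n : F) ^ d * χ ^ (n - 1 + j) * D ^ d := by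
      rw [hχ, mul_pow, mul_pow, mul_pow, ← pow_mul, ← pow_mul, ← pow_mul,
        mul_comm d, add_mul, pow_add]
      ring
    rw [h11]
    set W := ∏ b ∈ B.erase (a ^ n), b ^ c
    have h12 : χ ^ (n - 1 + j) = χ ^ (E * T) := by
      have : χ ^ (n - 1 + j) * χ ^ (E * T) = χ ^ (E * T) * χ ^ (E * T) := by
        rw [h9, ← pow_add, ← h8]
        congr 1
        ring
      exact mul_right_cancel₀ (pow_ne_zero _ hχ0) this
    rw [h12, ← h7]
    linear_combination (n : F) ^ d * (χ ^ E) ^ (T - 1) * D ^ d * W * h10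
  obtain ⟨lam, hlam, hsq⟩ := exists_isSquare_mul_of_pow_eq h2 hf0 hconst
  refine ⟨A, hA, j, hj01.imp_right fun h => ⟨h, fun h0 => hA0 0 h0 rfl⟩, lam, hlam, fun a ha => ?_⟩
  rw [mul_assoc]
  exact hsq a ha

end Multiplicative

/-! ### Divisibility of `p ^ m - 1` -/

section Arithmetic

lemma sub_one_mul_add_one_dvd {p m r : ℕ} (h : 2 * r ∣ m) :
    (p ^ r - 1) * (p ^ r + 1) ∣ p ^ m - 1 := by
  obtain ⟨k, rfl⟩ := h
  have h1 : (p ^ r - 1) * (p ^ r + 1) = p ^ (2 * r) - 1 := by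
    rw [mul_comm, ← Nat.sq_sub_sq (p ^ r) 1, one_pow, ← pow_mul, mul_comm r]
  rw [h1]
  exact Nat.pow_sub_one_dvd_pow_sub_one p ⟨k, rfl⟩

/-- If both `p ^ r - 1` and `p ^ r + 1` divide `p ^ m - 1`, then `m / r` is an even integer. -/
lemma two_mul_dvd_of_dvd {p m r : ℕ} (hp : 2 ≤ p) (hr : 1 ≤ r) (h₁ : p ^ r - 1 ∣ p ^ m - 1)
    (h₂ : p ^ r + 1 ∣ p ^ m - 1) : 2 * r ∣ m := by
  have hQ : 2 ≤ p ^ r := hp.trans (Nat.le_self_pow (by omega) p)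
  have hrm : r ∣ m := by
    have h3 := Nat.pow_sub_one_gcd_pow_sub_one p r m
    rw [Nat.gcd_eq_left h₁] at h3
    have h4 : 1 ≤ p ^ r.gcd m := Nat.one_le_pow _ _ (by omega)
    have h5 : p ^ r = p ^ r.gcd m := by omega
    have h6 := Nat.pow_right_injective hp h5
    exact h6 ▸ Nat.gcd_dvd_right r m
  obtain ⟨e, rfl⟩ := hrm
  rcases Nat.even_or_odd e with ⟨k, rfl⟩ | he
  · exact ⟨k, by ring⟩
  · exfalso
    have h3 : p ^ r + 1 ∣ (p ^ r) ^ e + 1 ^ e := he.nat_add_dvd_pow_add_pow _ _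
    rw [one_pow, ← pow_mul] at h3
    have h4 : 1 ≤ p ^ (r * e) := Nat.one_le_pow _ _ (by omega)
    have h5 := Nat.dvd_sub h3 h₂
    have h6 : p ^ (r * e) + 1 - (p ^ (r * e) - 1) = 2 := by omega
    rw [h6] at h5
    have := Nat.le_of_dvd (by omega) h5
    omega

lemma even_of_isSquare_prime_pow {p m : ℕ} (hp : p.Prime) (h : IsSquare (p ^ m)) : Even m := by
  obtain ⟨k, hk⟩ := h
  obtain ⟨j, -, rfl⟩ := (Nat.dvd_prime_pow hp).1 ⟨k, hk⟩
  rw [← pow_add] at hk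
  exact ⟨j, Nat.pow_right_injective hp.two_le hk⟩

end Arithmetic

/-- The parameters of a union of `t + 1` cosets as in `HasSquareWeights.of_mul_add_one_eq`:
since `p ^ r - 1` and `p ^ r + 1` both divide `q - 1`, so does their product. -/
lemma even_and_hasSquareWeights_of_mul_add_one_eq [DecidableEq F] {p m r n t c : ℕ} (hp : p.Prime)
    (hpodd : Odd p) (hF : Fintype.card F = p ^ m) (h2 : ringChar F ≠ 2) (hr : 1 ≤ r)
    (hn : n * (p ^ r + 1) = Fintype.card F - 1) (hc : n * (p ^ r + 1) = 2 * (p ^ r - 1) * c)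
    (ht : t + 1 ≤ (Fintype.card F - 2) / n) :
    Even ((t + 1) * n) ∧ HasSquareWeights F ((t + 1) * n) := by
  have hq : 1 < Fintype.card F := Fintype.one_lt_card
  have hn0 : 0 < n := by
    rcases Nat.eq_zero_or_pos n with rfl | h
    · omega
    · exact h
  have hdvd := two_mul_dvd_of_dvd (m := m) hp.two_le hr
    ⟨2 * c, by rw [← hF, ← hn, hc]; ring⟩ ⟨n, by rw [← hF, ← hn]; ring⟩
  obtain ⟨E, hE⟩ := sub_one_mul_add_one_dvd (p := p) hdvd
  have hnE : n = (p ^ r - 1) * E := by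
    apply Nat.eq_of_mul_eq_mul_right (Nat.succ_pos (p ^ r))
    rw [Nat.succ_eq_add_one, hn, hF, hE]
    ring
  have hneven : Even n := by
    rw [hnE]
    exact (Nat.Odd.sub_odd hpodd.pow odd_one).mul_right E
  have hT : t + 1 ≤ p ^ r + 1 := by
    by_contra hcon
    have h3 := (Nat.le_div_iff_mul_le hn0).1 ht
    have h4 : n * (p ^ r + 1) ≤ (t + 1) * n := by
      rw [mul_comm]
      exact Nat.mul_le_mul_right n (by omega)
    omega
  refine ⟨hneven.mul_left _, ?_⟩
  rw [mul_comm]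
  refine HasSquareWeights.of_mul_add_one_eq (c := c) hp hF h2 hn ?_ hnE (by omega) hT
  have h5 : Fintype.card F = 2 * ((p ^ r - 1) * c) + 1 := by
    rw [hn] at hc
    rw [← mul_assoc, ← hc]
    omega
  omega

end FiniteField

end LinearCode

/-! ### The families of lengths -/

theorem mainTheorem5 {F : Type*} [Field F] [Fintype F] [DecidableEq F]
    (p m q N K : ℕ) (hp : p.Prime) (hq : q = p ^ m) (hF : Fintype.card F = q)
    (hodd : Odd q) (hq5 : 5 < q) (hN : N ≤ q - 2)
    (hK : (Even N ∧ ∃ s : ℕ, 1 ≤ s ∧ s + 2 ≤ N / 2 ∧ K = N - 2 * s - 1) ∨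
      (Odd N ∧ ∃ s : ℕ, s + 3 ≤ (N + 1) / 2 ∧ K = N - 2 * s - 2))
    (hfam :
      -- (1)
      (p ∣ N ∧ (N - 1) ∣ (q - 1) ∧ Even N) ∨
      -- (2)
      (IsSquare q ∧ (N - 1) ∣ (q - 1) ∧ Even N) ∨
      -- (3) a), b)
      (N ∣ (q - 1) / 2 ∧ (Even N ∨ (q ≡ 1 [MOD 4] ∧ Odd N))) ∨
      -- (4)
      (∃ r n t c : ℕ, 1 ≤ r ∧ r < m ∧ n * (p ^ r + 1) = q - 1 ∧ IsSquare (n : F) ∧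
        n * (p ^ r + 1) = 2 * (p ^ r - 1) * c ∧ Odd c ∧
        Odd t ∧ 1 ≤ t ∧ t + 1 ≤ (q - 2) / n ∧ N = (t + 1) * n) ∨
      -- (5)
      (∃ r n t c : ℕ, 1 ≤ r ∧ r < m ∧ n * (p ^ r + 1) = q - 1 ∧ IsSquare (n : F) ∧
        n * (p ^ r + 1) = 2 * (p ^ r - 1) * c ∧ Even c ∧
        1 ≤ t ∧ t + 1 ≤ (q - 2) / n ∧ N = (t + 1) * n) ∨
      -- (6)
      (∃ r n t : ℕ, 1 ≤ r ∧ r < m ∧ n * (p ^ r - 1) = q - 1 ∧ IsSquare (n : F) ∧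
        Even m ∧ r ∣ m / 2 ∧ 1 ≤ t ∧ t ≤ p ^ r - 2 ∧ N = (t + 1) * n) ∨
      -- (7)
      (∃ m₀ q₀ t : ℕ, m = 2 * m₀ ∧ q₀ = p ^ m₀ ∧ Even t ∧ 1 ≤ t ∧ t < q₀ ∧ N = q₀ * t) ∨
      -- (8)
      (∃ m₀ q₀ t : ℕ, m = 2 * m₀ ∧ q₀ = p ^ m₀ ∧ Odd t ∧ 1 ≤ t ∧ t < q₀ ∧
        N = q₀ * t + 1) ∨
      -- (9)
      (∃ m₀ r l t : ℕ, Even m ∧ r = p ^ m₀ ∧ m₀ ∣ m / 2 ∧ l < m / m₀ ∧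
        1 ≤ t ∧ t ≤ min ((r - 1) / 2) ((q - 2) / (2 * r ^ l)) ∧ N = 2 * t * r ^ l) ∨
      -- (10)
      (∃ l : ℕ, q ≡ 1 [MOD 4] ∧ 0 < l ∧ l < m ∧ N = 2 * p ^ l) ∨
      -- (11)
      (∃ m₀ r l t : ℕ, Even m ∧ r = p ^ m₀ ∧ m₀ ∣ m / 2 ∧ l < m / m₀ ∧
        t ≤ min ((r - 1) / 2) ((q - 2 - r ^ l) / (2 * r ^ l)) ∧
        N = (2 * t + 1) * r ^ l + 1) ∨
      -- (12)
      (∃ l : ℕ, q ≡ 1 [MOD 4] ∧ 0 < l ∧ l < m ∧ N = p ^ l + 1)) :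
    (∃ C : Submodule F (Fin N → F), LinearCode.IsOneDimHullMDS C K) ∧
      (∃ C : Submodule F (Fin N → F), LinearCode.IsOneDimHullMDS C (N - K)) := by
  have h2 : ringChar F ≠ 2 := by
    rw [Ne, FiniteField.even_card_iff_char_two, hF]
    have := Nat.odd_iff.1 hodd
    omega
  have hFm : Fintype.card F = p ^ m := hF.trans hq
  have hpodd : Odd p := by
    have hm0 : m ≠ 0 := by
      rintro rfl
      rw [hq, pow_zero] at hq5
      omega
    rw [hq] at hodd
    exact (Nat.odd_pow_iff hm0).1 hodd
  have : Fact p.Prime := ⟨hp⟩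
  have hchar : CharP F p := charP_of_card_eq_prime_pow hFm
  have hN0 : 5 ≤ N := by
    rcases hK with ⟨-, s, h1, h3, -⟩ | ⟨-, s, h1, -⟩ <;> omega
  have hmod : q ≡ 1 [MOD 4] → IsSquare (-1 : F) := by
    intro h
    rw [FiniteField.isSquare_neg_one_iff, hF]
    have h3 : q % 4 = 1 % 4 := h
    omega
  have hneg : Even m → IsSquare (-1 : F) := LinearCode.isSquare_neg_one_of_even hFm h2
  -- every admissible length is either even with square weights, or an odd divisor of `q - 1`
  have key : (Even N → LinearCode.HasSquareWeights F N) ∧ (Odd N → N ∣ Fintype.card F - 1) := by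
    have hcase : Even N ∧ LinearCode.HasSquareWeights F N →
        (Even N → LinearCode.HasSquareWeights F N) ∧ (Odd N → N ∣ Fintype.card F - 1) :=
      fun h => ⟨fun _ => h.2, fun ho => absurd h.1 (Nat.not_even_iff_odd.2 ho)⟩
    rcases hfam with ⟨hpN, hd, hev⟩ | ⟨hsq, hd, hev⟩ | ⟨hd, -⟩ |
      ⟨r, n, t, c, hr, -, hn, -, hc, -, -, -, ht, hNt⟩ |
      ⟨r, n, t, c, hr, -, hn, -, hc, -, -, ht, hNt⟩ |
      ⟨r, n, t, hr, -, hn, -, hm, hrm, ht1, ht, hNt⟩ |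
      ⟨m₀, q₀, t, hm, hq₀, hte, ht1, ht, hNt⟩ | ⟨m₀, q₀, t, hm, hq₀, hto, ht1, ht, hNt⟩ |
      ⟨m₀, r, l, t, hm, hr, hm₀, hl, ht1, ht, hNt⟩ | ⟨l, h4, hl0, hl, hNt⟩ |
      ⟨m₀, r, l, t, hm, hr, hm₀, hl, ht, hNt⟩ | ⟨l, h4, hl0, hl, hNt⟩
    -- `p ∣ N`: both values `-1` and `N - 1` of the derivative of `X ^ N - X` are `-1`
    · refine hcase ⟨hev, .of_sub_one_dvd (lam := -1) (by omega) (by rwa [hF]) (by simp)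
        (by simp) ?_⟩
      rw [(CharP.cast_eq_zero_iff F p N).2 hpN]
      simp
    -- `q` a square: `-1` and `N - 1` lie in the prime field, whose elements are squares
    · have hm := LinearCode.even_of_isSquare_prime_pow hp (hq ▸ hsq)
      refine hcase ⟨hev, .of_sub_one_dvd (lam := 1) (by omega) (by rwa [hF]) one_ne_zero
        (by simpa using hneg hm) ?_⟩
      rw [one_mul]
      refine LinearCode.isSquare_of_pow_eq_self hFm h2 hm (one_dvd _) ?_
      rw [pow_one, sub_pow_char, one_pow]
      congr 1
      exact map_natCast (frobenius F p) N
    -- `N ∣ (q - 1) / 2`, the only family with odd lengths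
    · have hd' : N ∣ Fintype.card F - 1 := by
        refine hd.trans ⟨2, ?_⟩
        have := Nat.odd_iff.1 hodd
        omega
      exact ⟨fun _ => .of_dvd_sub_one hd', fun _ => hd'⟩
    -- cosets of the `n`-th roots of unity, `n = (q - 1) / (p ^ r + 1)`
    · exact hcase (hNt ▸ LinearCode.even_and_hasSquareWeights_of_mul_add_one_eq hp hpodd hFm h2 hr
        (by rw [hn, hF]) hc (by rwa [hF]))
    · exact hcase (hNt ▸ LinearCode.even_and_hasSquareWeights_of_mul_add_one_eq hp hpodd hFm h2 hr
        (by rw [hn, hF]) hc (by rwa [hF]))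
    -- cosets of the `n`-th roots of unity, `n = (q - 1) / (p ^ r - 1)`
    · have hQ : 2 ≤ p ^ r := hp.two_le.trans (Nat.le_self_pow (by omega) p)
      have hdvd : 2 * r ∣ m := by
        obtain ⟨k, hk⟩ := hrm
        obtain ⟨i, rfl⟩ := hm
        exact ⟨k, by rw [mul_assoc, ← hk]; omega⟩
      obtain ⟨E, hE⟩ := LinearCode.sub_one_mul_add_one_dvd (p := p) hdvd
      have hnE : n = (p ^ r + 1) * E := by
        apply Nat.eq_of_mul_eq_mul_right (by omega : 0 < p ^ r - 1)
        rw [hn, hq, hE]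
        ring
      have hneven : Even n := by
        rw [hnE]
        exact (hpodd.pow.add_odd odd_one).mul_right E
      refine hcase ⟨hNt ▸ hneven.mul_left _, ?_⟩
      rw [hNt, mul_comm]
      exact .of_mul_sub_one_eq hp hFm h2 hm hrm (by rw [hn, hF]) (by omega)
    -- `t` parallel lines over the subfield of order `q₀`
    · have hm₀0 : 0 < m₀ := by
        rcases Nat.eq_zero_or_pos m₀ with rfl | h
        · rw [pow_zero] at hq₀
          omega
        · exact h
      refine hcase ⟨hNt ▸ hte.mul_left _, ?_⟩
      obtain ⟨A, hA, E, hE, hsq⟩ := LinearCode.exists_isSquare_prod_sub_of_subfield (m₀ := m₀)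
        (l := 1) (t := t) hp hFm h2 ⟨m₀, by omega⟩ (by rw [hm, Nat.mul_div_cancel_left _ two_pos])
        (by rw [hm, Nat.mul_div_cancel _ hm₀0]; omega) (by omega)
      rw [pow_one, ← hq₀, mul_comm t, ← hNt] at hA
      exact .of_isSquare_mul hA (pow_ne_zero _ hE) hsq
    -- `t` parallel lines over the subfield of order `q₀`, and infinity
    · have hm₀0 : 0 < m₀ := by
        rcases Nat.eq_zero_or_pos m₀ with rfl | h
        · rw [pow_zero] at hq₀
          omega
        · exact h
      have hev : Even N := by
        rw [hNt, hq₀]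
        exact (hpodd.pow.mul hto).add_one
      refine hcase ⟨hev, ?_⟩
      rw [hNt] at hev hN ⊢
      refine .of_cosets_add_one (t := t) (hneg ⟨m₀, by omega⟩) hto hev (by rw [hF]; omega) ?_
      have := LinearCode.exists_isSquare_prod_sub_of_subfield (m₀ := m₀) (l := 1) (t := t) hp hFm h2
        ⟨m₀, by omega⟩ (by rw [hm, Nat.mul_div_cancel_left _ two_pos])
        (by rw [hm, Nat.mul_div_cancel _ hm₀0]; omega) (by omega)
      rwa [pow_one, ← hq₀, mul_comm t] at this
    -- `2 t` cosets of an `l`-dimensional subspace over the subfield of order `r`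
    · have ht' := (le_min_iff.1 ht).1
      refine hcase ⟨⟨t * r ^ l, by rw [hNt]; ring⟩, ?_⟩
      obtain ⟨A, hA, E, hE, hsq⟩ := LinearCode.exists_isSquare_prod_sub_of_subfield (t := 2 * t)
        hp hFm h2 hm hm₀ hl (by omega)
      rw [← hr, ← hNt] at hA
      exact .of_isSquare_mul hA (pow_ne_zero _ hE) hsq
    -- two cosets of an `l`-dimensional subspace over the prime field
    · refine hcase ⟨⟨p ^ l, by rw [hNt]; ring⟩, ?_⟩
      obtain ⟨A, hA, E, hE, hsq⟩ := LinearCode.exists_isSquare_prod_sub_of_primeField (t := 2)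
        hp hFm h2 (hmod h4) hl le_rfl
      exact .of_isSquare_mul (hA.trans hNt.symm) (pow_ne_zero _ hE) hsq
    -- `2 t + 1` cosets of an `l`-dimensional subspace over the subfield of order `r`, and infinity
    · have ht' := (le_min_iff.1 ht).1
      have hr1 : 1 ≤ r := hr ▸ Nat.one_le_pow _ _ hp.pos
      have hto : Odd (2 * t + 1) := odd_two_mul_add_one t
      have hev : Even N := by
        rw [hNt, hr]
        exact (hto.mul hpodd.pow.pow).add_one
      refine hcase ⟨hev, ?_⟩
      rw [hNt] at hev hN ⊢
      refine .of_cosets_add_one (t := 2 * t + 1) (hneg hm) hto hev (by rw [hF]; omega) ?_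
      have := LinearCode.exists_isSquare_prod_sub_of_subfield (t := 2 * t + 1) hp hFm h2 hm hm₀ hl
        (by omega)
      rwa [← hr] at this
    -- an `l`-dimensional subspace over the prime field, and infinity
    · have hev : Even N := by
        rw [hNt]
        exact hpodd.pow.add_one
      refine hcase ⟨hev, ?_⟩
      rw [hNt] at hev hN ⊢
      refine .of_cosets_add_one (t := 1) (hmod h4) odd_one hev (by rw [hF]; omega) ?_
      have := LinearCode.exists_isSquare_prod_sub_of_primeField (t := 1) hp hFm h2 (hmod h4) hl
        one_le_two
      rwa [one_mul] at this
  clear hfam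
  rcases hK with ⟨hev, s, hs1, hs, rfl⟩ | ⟨ho, s, hs, rfl⟩
  · exact (key.1 hev).exists_isOneDimHullMDS (by rw [hF]; omega) (by omega)
  · exact LinearCode.exists_isOneDimHullMDS_of_odd (key.2 ho) ho (by
      obtain ⟨j, rfl⟩ := ho
      omega)
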